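/- Let $T>0$, $d\in\mathbb N$, and let $w\in\mathbb R^{n_w}$, $x_p\in\mathbb R^{n_x}$, $u\in\mathbb R^{n_u}$. Consider $$\dot w=s(w),\qquad \dot x_p=f_p(w,x_p,u),\qquad y=h_p(w,x_p)=(e,y_a)\in\mathbb R^{n_e}\times\mathbb R^{n_a},$$ write $h_e$ for the first component of $h_p$ (so $e=h_e(w,x_p)$), and consider the regulator with state $x_c=(\eta,x_{st})$, $\eta\in\mathbb R^{(2d+1)n_e}$, $x_{st}\in\mathbb R^{n_{st}}$, $$\dot\eta=\Phi\eta+Ge,\qquad \dot x_{st}=f_{st}(x_{st},\eta,y),\qquad u=h_c(x_{st},\eta,y),\qquad x_c(0)\in X_c .$$ Solutions are forward in time, start at $t=0$, and are maximal (cannot be continued further). **Perturbations.** Let $F=(s,(f_p,h_p))$ range over $\mathcal F=\mathcal F_w\times\mathcal F_p$, where $\mathcal F_w$ is a set of $C^1$ maps with an arbitrary topology $\tau_{\mathcal F_w}$, and $\mathcal F_p$ is a set of pairs $(f_p,h_p)$ of $C^2$ maps with the weak $C^2$ topology $\tau_{\mathcal F_p}$ on $X_b\times U_b$, i.e. the topology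 of the semimetric $\max_{i\le 2}\sup_{X_b\times U_b}|F_p^{(i)}-G_p^{(i)}|$; here $X_b\subset\mathbb R^{n_w}\times\mathbb R^{n_x}$ and $U_b\subset\mathbb R^{n_u}$ are compact neighborhoods of the origins. Let $\mathcal X$ be the set of nonempty compact subsets of $\mathbb R^{n_w}\times\mathbb R^{n_x}$ with the Hausdorff topology $\tau_{\mathcal X}$, and put $\tau=\tau_{\mathcal F_w}\times\tau_{\mathcal F_p}\times\tau_{\mathcal X}$. Let $F^\circ=(s^\circ,(f_p^\circ,h_p^\circ))\in\mathcal F$ be the nominal value. **Assumptions.** 1. There is a neighborhood $\mathcal N_w$ of $s^\circ$ such that: for every $\epsilon>0$ there is $\delta>0$ such that, for all $s\in\mathcal N_w$, every solution of $\dot w=s(w)$ with $|w(0)|\le\delta$ satisfies $|w(t)|\le\epsilon$ for all $t\ge0$; and for all $s\in\mathcal N_w$, $\epsilon>0$ and compact $W\subset\mathbb R^{n_w}$ there is $r>0$ such that every solution of $\dot w=s(w)$ with $w(0)\in W$ satisfies $|w(t+T)-w(t)|\le\epsilon$ for all $t\ge r$. (Both inequalities are required only at times at which the solution is defined.) 2.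 The spectrum of $\Phi$ is $\{0\}\cup\{\pm i2\pi k/T: k=1,\dots,d\}$, each eigenvalue has algebraic and geometric multiplicity $n_e$, and $(\Phi,G)$ is controllable. The set $X_c$ is nonempty and compact, and $f_{st}$, $h_c$ are $C^2$. The nominal controlled plant with $w=0$, i.e. the system in $(x_p,x_c)$ obtained with $w=0$ and $(f_p,h_p)=(f_p^\circ,h_p^\circ)$, has a locally exponentially stable equilibrium whose domain of attraction includes $\{0\}\times X_c$. 3. $X_b$ and $U_b$ are large enough that the closure of the set of values $((0,x_p(t)),u(t))$, $t\ge0$, taken along the trajectories of the nominal controlled plant with $w=0$ starting in $\{0\}\times X_c$ is contained in the interior of $X_b\times U_b$. **Conclusion.** The regulator is $(\mathcal P_T,\tau)$-robust at $(F^\circ,\{0\})$. That is, there is a $\tau$-neighborhood $\mathcal N$ of $(F^\circ,\{0\})$ such that for every $(F,X)\in\mathcal N$ the following hold for the closed-loop system $\Sigma_{cl}(F,X)$, where $\mathcal R^t$ denotes the set of points $\xi(t')$ with $t'\ge t$ and $\xi$ a solution originating in $X\times X_c$: * (robust stability) $\Sigma_{cl}(F,X)$ is uniformly ultimately bounded from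 $X\times X_c$: for some $t\ge0$, $\mathcal R^t$ is nonempty and bounded; * ($\mathcal P_T$) every steady-state trajectory, i.e. every solution $\xi=(w,x_p,x_c)$ originating in the limit set $\Omega=\bigcap_{t\ge0}\overline{\mathcal R^t}$, is defined for all $t\ge0$, and along it $e(t)=h_e(w(t),x_p(t))$ satisfies $$\int_0^T e(t)\,e^{-i2\pi kt/T}\,dt=0\qquad\text{for } k=0,1,\dots,d .$$ -/

import Mathlib

open Set Filter Topology TopologicalSpace

/-- The Euclidean space `ℝⁿ`. -/
abbrev Euc (n : ℕ) : Type := EuclideanSpace ℝ (Fin n)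

/-! ### Systems, solutions and limit sets -/

/-- A curve `toFun` considered on a set `dom` of times; values outside `dom` carry no meaning. -/
structure Trajectory (E : Type*) where
  dom : Set ℝ
  toFun : ℝ → E

/-- An autonomous system `ξ' = field ξ` with output `out ξ`. -/
structure OutputSystem (E Y : Type*) where
  field : E → E
  out : E → Y

section Systems

variable {E : Type*} [NormedAddCommGroup E] [NormedSpace ℝ E]

/-- `x` is a (forward) solution of `ξ' = f ξ`: its domain is an interval `[0,b]`, `[0,b)` or
`[0,∞)` on which it is differentiable (one-sidedly at end points) and satisfies the equation. -/
def IsSolution (f : E → E) (x : Trajectory E) : Prop :=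
  (0 : ℝ) ∈ x.dom ∧ x.dom ⊆ Ici 0 ∧ x.dom.OrdConnected ∧
    ∀ t ∈ x.dom, HasDerivWithinAt x.toFun (f (x.toFun t)) x.dom t

/-- A maximal solution: one that cannot be continued further. -/
def IsMaximalSolution (f : E → E) (x : Trajectory E) : Prop :=
  IsSolution f x ∧
    ∀ y : Trajectory E, IsSolution f y → x.dom ⊆ y.dom → EqOn x.toFun y.toFun x.dom →
      y.dom = x.dom

/-- The set of all maximal solutions of `ξ' = f ξ` originating in `Ξ`. -/
def maxSolutions (f : E → E) (Ξ : Set E) : Set (Trajectory E) :=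
  {x | IsMaximalSolution f x ∧ x.toFun 0 ∈ Ξ}

/-- The reachable tail from time `t`. -/
def reachTail (f : E → E) (Ξ : Set E) (t : ℝ) : Set E :=
  {p | ∃ x ∈ maxSolutions f Ξ, ∃ s ∈ x.dom, t ≤ s ∧ p = x.toFun s}

/-- The limit set of `ξ' = f ξ` from `Ξ`. -/
def limitSet (f : E → E) (Ξ : Set E) : Set E :=
  ⋂ t ∈ Ici (0 : ℝ), closure (reachTail f Ξ t)

/-- Uniform ultimate boundedness of `ξ' = f ξ` from `Ξ`. -/
def UniformlyUltimatelyBounded (f : E → E) (Ξ : Set E) : Prop :=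
  ∃ K : Set E, Bornology.IsBounded K ∧
    ∃ t : ℝ, 0 ≤ t ∧ reachTail f Ξ t ⊆ K ∧ (reachTail f Ξ t).Nonempty

/-- The steady-state trajectories: maximal solutions originating in the limit set. -/
def steadyStateTrajectories (f : E → E) (Ξ : Set E) : Set (Trajectory E) :=
  maxSolutions f (limitSet f Ξ)

/-- The equilibrium `z₀` of `z' = g z` is locally exponentially stable and its domain of attraction
includes `Z`. -/
def LocallyExpStableAttracting (g : E → E) (z₀ : E) (Z : Set E) : Prop :=
  g z₀ = 0 ∧
  (∃ r > 0, ∃ c > 0, ∃ l > 0, ∀ z ∈ maxSolutions g (Metric.ball z₀ r), ∀ t ∈ z.dom,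
    ‖z.toFun t - z₀‖ ≤ c * Real.exp (-l * t) * ‖z.toFun 0 - z₀‖) ∧
  (∀ z ∈ maxSolutions g Z, z.dom = Ici 0 ∧ Tendsto z.toFun atTop (𝓝 z₀))

end Systems

/-- A steady-state property: a statement on a system and its set of steady-state trajectories. -/
def SteadyStateProperty (E Y : Type*) : Type _ :=
  OutputSystem E Y → Set (Trajectory E) → Prop

/-- The steady-state trajectories of `S` from `Ξ` enjoy `P`. -/
def EnjoysProperty {E Y : Type*} [NormedAddCommGroup E] [NormedSpace ℝ E]
    (S : OutputSystem E Y) (Ξ : Set E) (P : SteadyStateProperty E Y) : Prop :=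
  P S (steadyStateTrajectories S.field Ξ)

/-! ### Extended plant, regulator, closed loop and robustness -/

/-- The data of the extended plant `w' = s w`, `x' = f (w, x, u)`, `y = h (w, x)`. -/
structure ExtendedPlant (W X U Y : Type*) where
  s : W → W
  f : (W × X) × U → X
  h : W × X → Y

/-- The data of the regulator `x_c' = fc (x_c, y)`, `u = hc (x_c, y)`, `x_c(0) ∈ Xc`. -/
structure Regulator (C Y U : Type*) where
  fc : C × Y → C
  hc : C × Y → U
  Xc : Set C

/-- The controlled plant (state `(x, x_c)`) with the exogenous input frozen at the value `w`. -/
def controlledPlantField {W X U Y C : Type*} (f : (W × X) × U → X) (h : W × X → Y)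
    (R : Regulator C Y U) (w : W) : X × C → X × C :=
  fun z => (f ((w, z.1), R.hc (z.2, h (w, z.1))), R.fc (z.2, h (w, z.1)))

/-- The closed-loop system, with state `((w, x), x_c)` and output `y`: the cascade of the exosystem
into the controlled plant. -/
def closedLoop {W X U Y C : Type*} (F : ExtendedPlant W X U Y) (R : Regulator C Y U) :
    OutputSystem ((W × X) × C) Y where
  field := fun ξ =>
    ((F.s ξ.1.1, (controlledPlantField F.f F.h R ξ.1.1 (ξ.1.2, ξ.2)).1),
      (controlledPlantField F.f F.h R ξ.1.1 (ξ.1.2, ξ.2)).2)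
  out := fun ξ => F.h ξ.1

/-- The regulator `R` is `(P, τ)`-robust at `(F₀, X₀)`: on some `τ`-neighborhood of `(F₀, X₀)` the
closed loop is uniformly ultimately bounded from `X × Xc` and its steady-state trajectories
enjoy `P`. The class of plants is `{plant F | F : 𝓕}` and the sets of initial conditions are the
nonempty compact subsets of the extended state space. -/
def IsRobust {W X U Y C : Type*} [NormedAddCommGroup W] [NormedSpace ℝ W]
    [NormedAddCommGroup X] [NormedSpace ℝ X] [NormedAddCommGroup C] [NormedSpace ℝ C]
    {𝓕 : Type*} (plant : 𝓕 → ExtendedPlant W X U Y) (R : Regulator C Y U)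
    (P : SteadyStateProperty ((W × X) × C) Y)
    (τ : TopologicalSpace (𝓕 × NonemptyCompacts (W × X)))
    (F₀ : 𝓕) (X₀ : NonemptyCompacts (W × X)) : Prop :=
  ∃ N ∈ @nhds _ τ (F₀, X₀), ∀ p ∈ N,
    UniformlyUltimatelyBounded (closedLoop (plant p.1) R).field ((p.2 : Set (W × X)) ×ˢ R.Xc) ∧
    EnjoysProperty (closedLoop (plant p.1) R) ((p.2 : Set (W × X)) ×ˢ R.Xc) P

/-- The topology on nonempty compact sets induced by the Hausdorff distance. -/
@[reducible] noncomputable def hausdorffTopology (A : Type*) [NormedAddCommGroup A] :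
    TopologicalSpace (NonemptyCompacts A) :=
  (inferInstance : MetricSpace (NonemptyCompacts A)).toPseudoMetricSpace
    |>.toUniformSpace.toTopologicalSpace

/-- The product of two topologies. -/
@[reducible] def productTopology {A B : Type*} (τA : TopologicalSpace A) (τB : TopologicalSpace B) :
    TopologicalSpace (A × B) :=
  @instTopologicalSpaceProd A B τA τB

/-! ### The weak `C²` topology -/

section WeakC2

variable {W X U Y : Type*} [NormedAddCommGroup W] [NormedSpace ℝ W]
  [NormedAddCommGroup X] [NormedSpace ℝ X] [NormedAddCommGroup U] [NormedSpace ℝ U]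
  [NormedAddCommGroup Y] [NormedSpace ℝ Y]

/-- The pair `(f, h)` as one map of `((w, x), u)`. -/
def jointMap (F : ((W × X) × U → X) × (W × X → Y)) : (W × X) × U → X × Y :=
  fun p => (F.1 p, F.2 p.1)

/-- `max_{i ≤ 2} sup_{p ∈ Pb} |F^{(i)}(p) - G^{(i)}(p)|`, where `F^{(i)}` is the `i`-th derivative;
`edist` is the distance given by the operator norm, with values in `[0,∞]`. -/
noncomputable def weakC2Edist (Pb : Set ((W × X) × U))
    (F G : ((W × X) × U → X) × (W × X → Y)) : ENNReal :=
  ⨆ i : Fin 3, ⨆ p ∈ Pb,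
    edist (iteratedFDeriv ℝ (i : ℕ) (jointMap F) p) (iteratedFDeriv ℝ (i : ℕ) (jointMap G) p)

/-- The semimetric of the weak `C²` topology on a class `Fp` of pairs `(f, h)`. -/
@[reducible] noncomputable def weakC2PseudoEMetric (Pb : Set ((W × X) × U))
    (Fp : Set (((W × X) × U → X) × (W × X → Y))) : PseudoEMetricSpace Fp where
  edist F G := weakC2Edist Pb F.1 G.1
  edist_self F := by
    simp only [weakC2Edist, edist_self, ENNReal.iSup_zero]
  edist_comm F G := by
    simp only [weakC2Edist]
    exact iSup_congr fun i => iSup_congr fun p => iSup_congr fun _ => edist_comm _ _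
  edist_triangle F G H := by
    simp only [weakC2Edist]
    refine iSup_le fun i => iSup_le fun p => iSup_le fun hp => ?_
    refine (edist_triangle _ (iteratedFDeriv ℝ (i : ℕ) (jointMap G.1) p) _).trans
      (add_le_add ?_ ?_)
    · exact le_iSup_of_le i (le_iSup_of_le p (le_iSup_of_le hp le_rfl))
    · exact le_iSup_of_le i (le_iSup_of_le p (le_iSup_of_le hp le_rfl))

/-- The weak `C²` topology on `Fp` relative to `Pb`. -/
@[reducible] noncomputable def weakC2Topology (Pb : Set ((W × X) × U))
    (Fp : Set (((W × X) × U → X) × (W × X → Y))) : TopologicalSpace Fp :=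
  (weakC2PseudoEMetric Pb Fp).toUniformSpace.toTopologicalSpace

end WeakC2

/-! ### Linear internal models and the property `P_T` -/

/-- Controllability of `(A, B)`: the matrix `[B, AB, …, A^{n-1}B]` has full rank `n`. -/
def IsControllable {n m : ℕ} (A : Matrix (Fin n) (Fin n) ℝ) (B : Matrix (Fin n) (Fin m) ℝ) :
    Prop :=
  (Matrix.of fun (i : Fin n) (p : Fin n × Fin m) => (A ^ (p.1 : ℕ) * B) i p.2).rank = n

/-- The set `{0} ∪ {± i 2πk/T : k = 1, …, d}`. -/
def harmonicSpectrum (T : ℝ) (d : ℕ) : Set ℂ :=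
  {0} ∪ ⋃ k ∈ Finset.Icc 1 d,
    {Complex.I * (2 * Real.pi * k / T), -(Complex.I * (2 * Real.pi * k / T))}

/-- The pair `(Φ, G)`, with `Φ` of size `(2d+1) nₑ`, is an internal model of period `T` with `d`
harmonics: the spectrum of `Φ` is `harmonicSpectrum T d`, each eigenvalue has algebraic and
geometric multiplicity `nₑ`, and `(Φ, G)` is controllable. -/
structure IsHarmonicInternalModel (T : ℝ) (d ne : ℕ)
    (Φ : Matrix (Fin ((2 * d + 1) * ne)) (Fin ((2 * d + 1) * ne)) ℝ)
    (G : Matrix (Fin ((2 * d + 1) * ne)) (Fin ne) ℝ) : Prop where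
  spectrum_eq : spectrum ℂ (Φ.map (algebraMap ℝ ℂ)) = harmonicSpectrum T d
  algebraic_multiplicity : ∀ μ ∈ harmonicSpectrum T d,
    (Φ.map (algebraMap ℝ ℂ)).charpoly.rootMultiplicity μ = ne
  geometric_multiplicity : ∀ μ ∈ harmonicSpectrum T d,
    Module.finrank ℂ
      (Module.End.eigenspace (Matrix.toLin' (Φ.map (algebraMap ℝ ℂ))) μ) = ne
  controllable : IsControllable Φ G

/-- The regulator with a linear internal model, with state `(η, x_st)` and input `y = (e, y_a)`:
`η' = Φ η + G e`, `x_st' = fst (x_st, η, y)`, `u = hc (x_st, η, y)`. -/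
noncomputable def linearIMRegulator {N ne : ℕ} {S Ya U : Type*} (Φ : Matrix (Fin N) (Fin N) ℝ)
    (G : Matrix (Fin N) (Fin ne) ℝ) (fst : S × Euc N × (Euc ne × Ya) → S)
    (hc : S × Euc N × (Euc ne × Ya) → U) (Xc : Set (Euc N × S)) :
    Regulator (Euc N × S) (Euc ne × Ya) U where
  fc := fun q =>
    (Matrix.toEuclideanLin Φ q.1.1 + Matrix.toEuclideanLin G q.2.1, fst (q.1.2, q.1.1, q.2))
  hc := fun q => hc (q.1.2, q.1.1, q.2)
  Xc := Xc

/-- The (unnormalized) Fourier coefficient `c_k(α) = ∫₀ᵀ α(t) e^{-i 2π k t / T} dt ∈ ℂᵐ`. -/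
noncomputable def fourierCoefficient {m : ℕ} (T : ℝ) (k : ℕ) (α : ℝ → Euc m) : Fin m → ℂ :=
  fun j => ∫ t in (0 : ℝ)..T,
    ((α t j : ℝ) : ℂ) * Complex.exp (-(Complex.I * 2 * Real.pi * k * t / T))

/-- The functions whose Fourier coefficients of index `0, …, d` vanish. -/
def vanishingHarmonics (T : ℝ) (d m : ℕ) : Set (ℝ → Euc m) :=
  {α | ∀ k ≤ d, fourierCoefficient T k α = 0}

/-- The property `P_T`: along every steady-state trajectory (which exists for all times `t ≥ 0`)
the error `e`, the first component of the output, has zero Fourier coefficients `0, …, d`. -/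
def propertyPT {E Ya : Type*} (T : ℝ) (d ne : ℕ) : SteadyStateProperty E (Euc ne × Ya) :=
  fun S O => ∀ ξ ∈ O, Ici 0 ⊆ ξ.dom ∧
    (fun t => (S.out (ξ.toFun t)).1) ∈ vanishingHarmonics T d ne

/-! ### Assumptions on the exosystem and the nominal excursion -/

/-- The exosystem assumption for the class `Fw`, topologized by `τw`: on a neighborhood of `s₀` the
origin is marginally stable uniformly in `s`, and for each `s` the solutions satisfy
`|w(t+T) - w(t)| → 0` uniformly over compact sets of initial conditions. (Inequalities are required
only where the maximal solutions are defined.) -/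
def ExosystemAssumption {W : Type*} [NormedAddCommGroup W] [NormedSpace ℝ W] (T : ℝ)
    (Fw : Set (W → W)) (τw : TopologicalSpace Fw) (s₀ : Fw) : Prop :=
  ∃ Nw ∈ @nhds _ τw s₀,
    (∀ ε > 0, ∃ δ > 0, ∀ s ∈ Nw, ∀ w ∈ maxSolutions s.1 univ, ‖w.toFun 0‖ ≤ δ →
      ∀ t ∈ w.dom, ‖w.toFun t‖ ≤ ε) ∧
    (∀ s ∈ Nw, ∀ ε > 0, ∀ K : Set W, IsCompact K → ∃ r > 0, ∀ w ∈ maxSolutions s.1 K,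
      ∀ t ≥ r, t + T ∈ w.dom → ‖w.toFun (t + T) - w.toFun t‖ ≤ ε)

/-- The values `((0, x(t)), u(t))` taken along the trajectories of the controlled plant with `w = 0`
originating in `{0} × Xc`. -/
def zeroInputExcursion {W X U Y C : Type*} [Zero W]
    [NormedAddCommGroup X] [NormedSpace ℝ X] [NormedAddCommGroup C] [NormedSpace ℝ C]
    (f : (W × X) × U → X) (h : W × X → Y) (R : Regulator C Y U) : Set ((W × X) × U) :=
  {p | ∃ z ∈ maxSolutions (controlledPlantField f h R 0) ({0} ×ˢ R.Xc), ∃ t ∈ z.dom,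
    p = ((0, (z.toFun t).1), R.hc ((z.toFun t).2, h (0, (z.toFun t).1)))}

/-!
The closed loop is a cascade: the exosystem `w' = s w` drives the controlled plant
`z' = g (w, z)`, `z = (x, x_c)`. Near the nominal value the proof shows that every steady-state
trajectory is `T`-periodic; the internal model then forces the harmonics of the error to vanish.

*Stability.* Exponential stability of the nominal equilibrium `z₀` bounds the semigroup of the
linearization `A` (`norm_exp_smul_fderiv_apply_le`), so that `exp (t A)` is a strict contraction in
the norm `sup_{t ≥ 0} e^{l t} ‖exp (t A) v‖` (`exists_isAdaptedNorm`). Closeness in the weak `C²`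
topology gives closeness of `g` and of its derivative in `z` along the nominal trajectories and at
`z₀` (`tendsto_controlledPlantField`); this is where the excursion has to lie in the interior of
`Xb × Ub`. Hence perturbed trajectories with small `w` follow a nominal trajectory until they are
near `z₀`, and stay there. Two of them approach each other up to a multiple of the difference of
their inputs. By compactness of `Xc` all this is uniform (`exists_uniform_attraction`).

*Periodicity.* Comparing `z (t + T)` with `z t`, the convergence `w (t + T) - w t → 0` implies
`z (t + T) - z t → 0`, uniformly over the initial conditions
(`closedLoop_bounded_and_periodic`). A point of the limit set is a limit of points `ξ (t)` with
`t → ∞`, so by continuous dependence the solution through it returns to it after time `T`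
(`steadyStateTrajectories_periodic`). Invariance of the limit set is not needed.

*Harmonics.* If `η' = Φ η + G e` and `η T = η 0`, integration by parts shows that for
`μ = i 2πk/T` the Fourier integral `c` of `e` satisfies `G c ∈ range (Φ - μ)`. By controllability
`[Φ - μ, G]` has full row rank, and `ker (Φ - μ)` has as many dimensions as `G` has columns, so
`c = 0` (`eq_zero_of_mulVec_add_mulVec_eq_zero`).
-/

/-! ### Maximal solutions -/

section ODE

variable {E : Type*} [NormedAddCommGroup E] [NormedSpace ℝ E]

lemma IsSolution.continuousOn {f : E → E} {x : Trajectory E} (hx : IsSolution f x) :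
    ContinuousOn x.toFun x.dom := fun t ht => (hx.2.2.2 t ht).continuousWithinAt

lemma IsSolution.Icc_subset {f : E → E} {x : Trajectory E} (hx : IsSolution f x) {a b : ℝ}
    (ha : 0 ≤ a) (hb : b ∈ x.dom) : Icc a b ⊆ x.dom :=
  (Icc_subset_Icc_left ha).trans (hx.2.2.1.out hx.1 hb)

lemma HasDerivWithinAt.Ici_of_Icc {y : ℝ → E} {y' : E} {s : Set ℝ} {a b t : ℝ}
    (h : HasDerivWithinAt y y' s t) (hs : Icc a b ⊆ s) (ht : t ∈ Ico a b) :
    HasDerivWithinAt y y' (Ici t) t :=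
  h.mono_of_mem_nhdsWithin (mem_of_superset (Icc_mem_nhdsGE ht.2)
    ((Icc_subset_Icc_left ht.1).trans hs))

lemma IsSolution.hasDerivWithinAt_Ici {f : E → E} {x : Trajectory E} (hx : IsSolution f x)
    {a b t : ℝ} (ha : 0 ≤ a) (hb : b ∈ x.dom) (ht : t ∈ Ico a b) :
    HasDerivWithinAt x.toFun (f (x.toFun t)) (Ici t) t :=
  (hx.2.2.2 t (hx.Icc_subset ha hb (Ico_subset_Icc_self ht))).Ici_of_Icc
    (hx.Icc_subset ha hb) ht

/-- The union of a chain of solutions is a solution: at each time one member of the chain agrees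
with the union on a relative neighbourhood. -/
lemma exists_maximalExtension {f : E → E} {x : Trajectory E} (hx : IsSolution f x) :
    ∃ y, IsMaximalSolution f y ∧ x.dom ⊆ y.dom ∧ EqOn x.toFun y.toFun x.dom := by
  let S := {y : Trajectory E // IsSolution f y ∧ x.dom ⊆ y.dom ∧ EqOn x.toFun y.toFun x.dom}
  let r : S → S → Prop := fun y z => y.1.dom ⊆ z.1.dom ∧ EqOn y.1.toFun z.1.toFun y.1.dom
  have hrefl : ∀ y, r y y := fun y => ⟨Subset.rfl, fun _ _ => rfl⟩
  have htrans : ∀ {y z w}, r y z → r z w → r y w := fun h1 h2 =>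
    ⟨h1.1.trans h2.1, fun t ht => (h1.2 ht).trans (h2.2 (h1.1 ht))⟩
  have hchain : ∀ c, IsChain r c → c.Nonempty → ∃ ub, ∀ a ∈ c, r a ub := by
    intro c hc hne
    classical
    have hdir : ∀ y ∈ c, ∀ z ∈ c, r y z ∨ r z y := by
      intro y hy z hz
      by_cases h : y = z
      · subst h; exact Or.inl (hrefl y)
      · exact hc hy hz h
    let D : Set ℝ := ⋃ y ∈ c, y.1.dom
    have hD : ∀ {t}, t ∈ D ↔ ∃ y ∈ c, t ∈ y.1.dom := by intro t; simp [D]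
    let F : ℝ → E := fun t => if h : ∃ y ∈ c, t ∈ y.1.dom then h.choose.1.toFun t else 0
    have hF : ∀ y ∈ c, EqOn y.1.toFun F y.1.dom := by
      intro y hy t ht
      have h : ∃ y ∈ c, t ∈ y.1.dom := ⟨y, hy, ht⟩
      have : F t = h.choose.1.toFun t := dif_pos h
      rw [this]
      obtain ⟨h1, h2⟩ := h.choose_spec
      rcases hdir y hy _ h1 with h3 | h3
      · exact h3.2 ht
      · exact (h3.2 h2).symm
    have hsub : D ⊆ Ici 0 := by
      intro t ht
      obtain ⟨y, -, hyt⟩ := hD.1 ht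
      exact y.2.1.2.1 hyt
    have h0 : ∀ y ∈ c, ∀ t ∈ y.1.dom, Icc 0 t ⊆ y.1.dom := fun y hy t ht =>
      y.2.1.Icc_subset le_rfl ht
    obtain ⟨y₀, hy₀⟩ := hne
    have hsol : IsSolution f ⟨D, F⟩ := by
      refine ⟨hD.2 ⟨y₀, hy₀, y₀.2.1.1⟩, hsub, ⟨?_⟩, ?_⟩
      · intro a ha b hb t ht
        obtain ⟨y, hy, hyb⟩ := hD.1 hb
        exact hD.2 ⟨y, hy, h0 y hy b hyb ⟨(hsub ha).trans ht.1, ht.2⟩⟩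
      · intro t ht
        -- choose a member of the chain reaching beyond `t`, or `t` is the last time
        obtain ⟨y, hy, hyt, hnear⟩ : ∃ y ∈ c, t ∈ y.1.dom ∧ y.1.dom ∈ 𝓝[D] t := by
          by_cases hmax : ∃ t' ∈ D, t < t'
          · obtain ⟨t', ht', hlt⟩ := hmax
            obtain ⟨y, hy, hyt⟩ := hD.1 ht'
            refine ⟨y, hy, h0 y hy t' hyt ⟨hsub ht, hlt.le⟩, ?_⟩
            filter_upwards [self_mem_nhdsWithin,
              mem_nhdsWithin_of_mem_nhds (Iio_mem_nhds hlt)] with u hu hu'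
            exact h0 y hy t' hyt ⟨hsub hu, le_of_lt hu'⟩
          · push Not at hmax
            obtain ⟨y, hy, hyt⟩ := hD.1 ht
            refine ⟨y, hy, hyt, ?_⟩
            filter_upwards [self_mem_nhdsWithin] with u hu
            exact h0 y hy t hyt ⟨hsub hu, hmax u hu⟩
        have hd := y.2.1.2.2.2 t hyt
        have hd2 : HasDerivWithinAt y.1.toFun (f (y.1.toFun t)) D t :=
          hd.mono_of_mem_nhdsWithin hnear
        change HasDerivWithinAt F (f (F t)) D t
        rw [← hF y hy hyt]
        refine hd2.congr_of_eventuallyEq ?_ (hF y hy hyt).symm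
        filter_upwards [hnear] with u hu using (hF y hy hu).symm
    have hle : ∀ y ∈ c, y.1.dom ⊆ D ∧ EqOn y.1.toFun F y.1.dom := fun y hy =>
      ⟨fun t ht => hD.2 ⟨y, hy, ht⟩, hF y hy⟩
    exact ⟨⟨⟨D, F⟩, hsol, y₀.2.2.1.trans (hle y₀ hy₀).1,
      fun t ht => (y₀.2.2.2 ht).trans (hF y₀ hy₀ (y₀.2.2.1 ht))⟩, hle⟩
  have : Nonempty S := ⟨⟨x, hx, Subset.rfl, fun _ _ => rfl⟩⟩
  obtain ⟨m, hm⟩ := exists_maximal_of_nonempty_chains_bounded hchain htrans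
  exact ⟨m.1, ⟨m.2.1, fun y hy h1 h2 =>
    ((hm ⟨y, hy, m.2.2.1.trans h1, fun t ht => (m.2.2.2 ht).trans (h2 (m.2.2.1 ht))⟩
      ⟨h1, h2⟩).1).antisymm h1⟩, m.2.2⟩

lemma exists_isMaximalSolution (f : E → E) (p : E) :
    ∃ y : Trajectory E, IsMaximalSolution f y ∧ y.toFun 0 = p := by
  have hx : IsSolution f ⟨{0}, fun _ => p⟩ := by
    refine ⟨rfl, by simp, ordConnected_singleton, ?_⟩
    rintro t rfl
    exact HasFDerivWithinAt.of_subsingleton subsingleton_singleton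
  obtain ⟨y, hy, -, h⟩ := exists_maximalExtension hx
  exact ⟨y, hy, (h rfl).symm⟩

lemma IsSolution.isMaximalSolution_of_dom_eq {f : E → E} {x : Trajectory E} (hx : IsSolution f x)
    (hdom : x.dom = Ici 0) : IsMaximalSolution f x :=
  ⟨hx, fun _ hy h _ => (hy.2.1.trans hdom.ge).antisymm h⟩

lemma eqOn_Icc_of_contDiff [FiniteDimensional ℝ E] {f : E → E} (hf : ContDiff ℝ 1 f)
    {y z : ℝ → E} {b : ℝ}
    (hy : ContinuousOn y (Icc 0 b)) (hy' : ∀ t ∈ Ico 0 b, HasDerivWithinAt y (f (y t)) (Ici t) t)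
    (hz : ContinuousOn z (Icc 0 b)) (hz' : ∀ t ∈ Ico 0 b, HasDerivWithinAt z (f (z t)) (Ici t) t)
    (h0 : y 0 = z 0) : EqOn y z (Icc 0 b) := by
  obtain ⟨R, hR⟩ : ∃ R, ∀ t ∈ Icc 0 b, y t ∈ Metric.closedBall (0 : E) R ∧
      z t ∈ Metric.closedBall (0 : E) R := by
    obtain ⟨R₁, h₁⟩ := (isCompact_Icc.image_of_continuousOn hy).isBounded.subset_closedBall 0
    obtain ⟨R₂, h₂⟩ := (isCompact_Icc.image_of_continuousOn hz).isBounded.subset_closedBall 0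
    exact ⟨max R₁ R₂, fun t ht =>
      ⟨Metric.closedBall_subset_closedBall (le_max_left _ _) (h₁ (mem_image_of_mem _ ht)),
        Metric.closedBall_subset_closedBall (le_max_right _ _) (h₂ (mem_image_of_mem _ ht))⟩⟩
  obtain ⟨K, hK⟩ := (hf.contDiffOn (s := Metric.closedBall 0 R)).exists_lipschitzOnWith one_ne_zero
    (convex_closedBall 0 R) (isCompact_closedBall 0 R)
  exact ODE_solution_unique_of_mem_Icc_right (v := fun _ => f)
    (s := fun _ => Metric.closedBall 0 R) (fun t _ => hK) hy hy'
    (fun t ht => (hR t (Ico_subset_Icc_self ht)).1) hz hz'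
    (fun t ht => (hR t (Ico_subset_Icc_self ht)).2) h0

/-- A `C¹` field agrees on a ball with a bounded, globally Lipschitz field. -/
lemma exists_bounded_lipschitz_eqOn_closedBall [FiniteDimensional ℝ E] {f : E → E}
    (hf : ContDiff ℝ 1 f) (R : ℝ) :
    ∃ (g : E → E) (K L : NNReal), LipschitzWith K g ∧ (∀ p, ‖g p‖ ≤ L) ∧
      EqOn g f (Metric.closedBall 0 R) := by
  let χ : ContDiffBump (0 : E) := ⟨max R 1, max R 1 + 1, by positivity, by linarith⟩
  have hg : ContDiff ℝ 1 (fun p => χ p • f p) := χ.contDiff.smul hf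
  have hgs : HasCompactSupport (fun p => χ p • f p) := χ.hasCompactSupport.smul_right
  obtain ⟨K, hK⟩ := hg.lipschitzWith_of_hasCompactSupport hgs one_ne_zero
  obtain ⟨L, hL⟩ := hgs.exists_bound_of_continuous hg.continuous
  refine ⟨_, K, L.toNNReal, hK, fun p => (hL p).trans (Real.le_coe_toNNReal L), fun p hp => ?_⟩
  have : χ p = 1 := χ.one_of_mem_closedBall
    (Metric.closedBall_subset_closedBall (le_max_left _ _) hp)
  simp [this]

/-- A field bounded by `L` cannot leave the ball of radius `L b` within time `b`, so that the
Picard-Lindelöf theorem applies on the whole of `[0, b]`. -/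
lemma exists_solution_Icc_of_bounded_lipschitz [CompleteSpace E] {g : E → E} {K L : NNReal}
    (hK : LipschitzWith K g) (hL : ∀ p, ‖g p‖ ≤ L) (p : E) {b : ℝ} (hb : 0 ≤ b) :
    ∃ γ : ℝ → E, γ 0 = p ∧ ∀ t ∈ Icc 0 b, HasDerivWithinAt γ (g (γ t)) (Icc 0 b) t := by
  have h : IsPicardLindelof (fun _ => g) (⟨0, left_mem_Icc.2 hb⟩ : Icc 0 b) p
      (L * b.toNNReal) 0 L K :=
    { lipschitzOnWith := fun _ _ => hK.lipschitzOnWith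
      continuousOn := fun _ _ => continuousOn_const
      norm_le := fun _ _ _ _ => hL _
      mul_max_le := by simp [hb] }
  exact h.exists_eq_forall_mem_Icc_hasDerivWithinAt₀

/-- A maximal solution of a `C¹` field that stays bounded exists for all positive times. -/
lemma IsMaximalSolution.dom_eq_Ici [FiniteDimensional ℝ E] {f : E → E} (hf : ContDiff ℝ 1 f)
    {x : Trajectory E} (hx : IsMaximalSolution f x) {R : ℝ} (hR : ∀ t ∈ x.dom, ‖x.toFun t‖ ≤ R) :
    x.dom = Ici 0 := by
  have hxs := hx.1
  by_contra hne
  obtain ⟨b, hb0, hb⟩ : ∃ b, 0 ≤ b ∧ b ∉ x.dom := by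
    by_contra! h
    exact hne (hxs.2.1.antisymm fun t ht => h t ht)
  have hlt : ∀ t ∈ x.dom, t < b := fun t ht => by
    by_contra! h
    exact hb (hxs.Icc_subset le_rfl ht ⟨hb0, h⟩)
  obtain ⟨g, K, L, hK, hL, hgf⟩ := exists_bounded_lipschitz_eqOn_closedBall hf (R + 1)
  obtain ⟨γ, hγ0, hγ⟩ := exists_solution_Icc_of_bounded_lipschitz hK hL (x.toFun 0)
    (add_nonneg hb0 zero_le_one)
  have hγc : ContinuousOn γ (Icc 0 (b + 1)) := fun t ht => (hγ t ht).continuousWithinAt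
  have heq : EqOn γ x.toFun x.dom := by
    intro t ht
    have htb := hlt t ht
    have ht0 := hxs.2.1 ht
    refine ODE_solution_unique_of_mem_Icc_right (v := fun _ => g) (s := fun _ => univ)
      (a := 0) (b := t)
      (fun _ _ => hK.lipschitzOnWith) (hγc.mono (Icc_subset_Icc_right (by linarith)))
      (fun s hs => (hγ s ⟨hs.1, by linarith [hs.2]⟩).Ici_of_Icc Subset.rfl
        ⟨hs.1, by linarith [hs.2]⟩)
      (fun _ _ => trivial) (hxs.continuousOn.mono (hxs.Icc_subset le_rfl ht))
      (fun s hs => ?_) (fun _ _ => trivial) hγ0 ⟨ht0, le_rfl⟩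
    rw [hgf]
    · exact hxs.hasDerivWithinAt_Ici le_rfl ht hs
    · have := hR s (hxs.Icc_subset le_rfl ht (Ico_subset_Icc_self hs))
      simpa using this.trans (by linarith)
  set c := sSup x.dom with hc
  have hbdd : BddAbove x.dom := ⟨b, fun t ht => (hlt t ht).le⟩
  have hc0 : 0 ≤ c := le_csSup hbdd hxs.1
  have hcb : c ≤ b := csSup_le ⟨0, hxs.1⟩ fun t ht => (hlt t ht).le
  have hsub : x.dom ⊆ Icc 0 c := fun t ht => ⟨hxs.2.1 ht, le_csSup hbdd ht⟩
  have hcI : c ∈ Icc 0 (b + 1) := ⟨hc0, by linarith⟩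
  have hγR : ∀ t ∈ Icc 0 c, ‖γ t‖ ≤ R := by
    have hcl : Icc 0 c ⊆ closure x.dom := by
      intro t ht
      rcases ht.2.lt_or_eq with h | h
      · obtain ⟨s, hs, hts⟩ := exists_lt_of_lt_csSup ⟨0, hxs.1⟩ h
        exact subset_closure (hxs.Icc_subset le_rfl hs ⟨ht.1, hts.le⟩)
      · rw [h]; exact csSup_mem_closure ⟨0, hxs.1⟩ hbdd
    intro t ht
    have hsubb : x.dom ⊆ Icc 0 (b + 1) := hsub.trans (Icc_subset_Icc_right (by linarith))
    have hct : ContinuousWithinAt (fun s => ‖γ s‖) x.dom t :=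
      ((hγc t ⟨ht.1, by linarith [ht.2]⟩).mono hsubb).norm
    exact hct.closure_le (hcl ht) continuousWithinAt_const fun s hs => by
      rw [heq hs]; exact hR s hs
  -- the comparison curve stays in the region `g = f` slightly beyond the supremum of the domain
  obtain ⟨δ, hδ, hδb, hδR⟩ : ∃ δ > 0, c + δ ≤ b + 1 ∧ ∀ t ∈ Icc 0 (c + δ), ‖γ t‖ ≤ R + 1 := by
    have h1 : ∀ᶠ s in 𝓝[Icc 0 (b + 1)] c, ‖γ s‖ < R + 1 :=
      (hγc c hcI).norm.eventually_lt_const (by linarith [hγR c ⟨hc0, le_rfl⟩])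
    obtain ⟨ε, hε, hεs⟩ := Metric.mem_nhdsWithin_iff.1 h1
    refine ⟨min (ε / 2) 1, by positivity, by linarith [min_le_right (ε / 2) 1], fun t ht => ?_⟩
    rcases le_or_gt t c with h | h
    · linarith [hγR t ⟨ht.1, h⟩]
    · have h2 : ‖γ t‖ < R + 1 := hεs ⟨by
        rw [Metric.mem_ball, Real.dist_eq, abs_of_pos (by linarith)]
        linarith [ht.2, min_le_left (ε / 2) 1], ht.1, by linarith [ht.2, min_le_right (ε / 2) 1]⟩
      exact h2.le
  have hy : IsSolution f ⟨Icc 0 (c + δ), γ⟩ := by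
    refine ⟨⟨le_rfl, by linarith⟩, fun t ht => ht.1, ordConnected_Icc, fun t ht => ?_⟩
    have := (hγ t ⟨ht.1, ht.2.trans hδb⟩).mono (Icc_subset_Icc_right hδb)
    rwa [hgf (by simpa using hδR t ht)] at this
  have := hx.2 _ hy (hsub.trans (Icc_subset_Icc_right (by linarith))) heq.symm
  have h3 : c + δ ∈ x.dom := by
    rw [← this]; exact ⟨by linarith, le_rfl⟩
  linarith [(hsub h3).2]

lemma HasDerivWithinAt.Ici_comp_const_add {y : ℝ → E} {y' : E} {s t : ℝ}
    (h : HasDerivWithinAt y y' (Ici (s + t)) (s + t)) :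
    HasDerivWithinAt (fun u => y (s + u)) y' (Ici t) t := by
  have h1 : HasDerivWithinAt (fun u : ℝ => s + u) 1 (Ici t) t :=
    ((hasDerivAt_id t).const_add s).hasDerivWithinAt
  have := HasDerivWithinAt.scomp t h h1 (fun u hu => by
    simpa using (hu : t ≤ u))
  simpa [Function.comp_def] using this

lemma IsSolution.continuousOn_const_add {f : E → E} {x : Trajectory E} (hx : IsSolution f x)
    (hdom : x.dom = Ici 0) {s a b : ℝ} (h : 0 ≤ s + a) :
    ContinuousOn (fun u => x.toFun (s + u)) (Icc a b) :=
  hx.continuousOn.comp (by fun_prop) fun u hu => by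
    rw [hdom, mem_Ici]; linarith [hu.1]

lemma IsSolution.hasDerivWithinAt_const_add {f : E → E} {x : Trajectory E} (hx : IsSolution f x)
    (hdom : x.dom = Ici 0) {s t : ℝ} (h : 0 ≤ s + t) :
    HasDerivWithinAt (fun u => x.toFun (s + u)) (f (x.toFun (s + t))) (Ici t) t :=
  (hx.hasDerivWithinAt_Ici h (b := s + t + 1) (by rw [hdom, mem_Ici]; linarith)
    ⟨le_rfl, by linarith⟩).Ici_comp_const_add

/-- If the solutions from `Ξ` are bounded and their increments over time `T` tend to zero uniformly,
then every steady-state trajectory is `T`-periodic: its initial point is a limit of points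
`x (s)`, `s → ∞`, and by continuous dependence its value at time `T` is the limit of
`x (s + T)`. -/
lemma steadyStateTrajectories_periodic [FiniteDimensional ℝ E] {f : E → E} (hf : ContDiff ℝ 1 f)
    {Ξ : Set E} {R T : ℝ} (hT : 0 ≤ T)
    (hglob : ∀ x ∈ maxSolutions f Ξ, x.dom = Ici 0 ∧ ∀ t ∈ Ici (0 : ℝ), ‖x.toFun t‖ ≤ R)
    (hper : ∀ m > 0, ∃ r, ∀ x ∈ maxSolutions f Ξ, ∀ t ≥ r, ‖x.toFun (t + T) - x.toFun t‖ ≤ m)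
    {ξ : Trajectory E} (hξ : ξ ∈ steadyStateTrajectories f Ξ) :
    ξ.dom = Ici 0 ∧ ξ.toFun T = ξ.toFun 0 := by
  obtain ⟨g, K, L, hK, hL, hgf⟩ := exists_bounded_lipschitz_eqOn_closedBall hf R
  set p := ξ.toFun 0 with hp
  have hpl : p ∈ limitSet f Ξ := hξ.2
  have hξs := hξ.1.1
  -- shadowing of the solution from `p` by late pieces of solutions from `Ξ`
  have key : ∀ b, 0 ≤ b → ∀ γ : ℝ → E, γ 0 = p →
      (∀ t ∈ Icc 0 b, HasDerivWithinAt γ (g (γ t)) (Icc 0 b) t) → ∀ η > 0, ∀ r,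
      ∃ x ∈ maxSolutions f Ξ, ∃ s, 0 ≤ s ∧ r ≤ s ∧
        ∀ t ∈ Icc 0 b, dist (γ t) (x.toFun (s + t)) ≤ η * Real.exp (K * t) := by
    intro b hb γ hγ0 hγ η hη r
    have hcl : p ∈ closure (reachTail f Ξ (max r 0)) :=
      mem_iInter₂.1 hpl (max r 0) (mem_Ici.2 (le_max_right _ _))
    obtain ⟨q, ⟨x, hx, s, hs, hrs, rfl⟩, hq⟩ := Metric.mem_closure_iff.1 hcl η hη
    have hs0 : 0 ≤ s := (le_max_right _ _).trans hrs
    refine ⟨x, hx, s, hs0, (le_max_left _ _).trans hrs, fun t ht => ?_⟩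
    have hdom := (hglob x hx).1
    have := dist_le_of_trajectories_ODE (v := fun _ => g) (K := K) (a := 0) (b := b) (f := γ)
      (g := fun u => x.toFun (s + u)) (δ := η)
      (fun _ => hK) (fun u hu => (hγ u hu).continuousWithinAt)
      (fun u hu => (hγ u (Ico_subset_Icc_self hu)).Ici_of_Icc Subset.rfl hu)
      (hx.1.1.continuousOn_const_add hdom (by linarith))
      (fun u hu => ?_) (by rw [hγ0, add_zero]; exact hq.le) t ht
    · simpa using this
    · rw [hgf (by simpa using (hglob x hx).2 _ (by simp; linarith [hu.1]))]
      exact hx.1.1.hasDerivWithinAt_const_add hdom (by linarith [hu.1])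
  have hstep : ∀ b, 0 ≤ b → ∃ γ : ℝ → E, γ 0 = p ∧
      (∀ t ∈ Icc 0 b, HasDerivWithinAt γ (g (γ t)) (Icc 0 b) t) ∧ (∀ t ∈ Icc 0 b, ‖γ t‖ ≤ R) ∧
      (b ∈ ξ.dom → EqOn ξ.toFun γ (Icc 0 b)) := by
    intro b hb
    obtain ⟨γ, hγ0, hγ⟩ := exists_solution_Icc_of_bounded_lipschitz hK hL p hb
    have hR : ∀ t ∈ Icc 0 b, ‖γ t‖ ≤ R := by
      intro t ht
      refine le_of_forall_pos_le_add fun ε hε => ?_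
      obtain ⟨x, hx, s, hs0, -, h⟩ := key b hb γ hγ0 hγ (ε / Real.exp (K * t)) (by positivity) 0
      have h1 := h t ht
      rw [div_mul_cancel₀ _ (Real.exp_ne_zero _), dist_eq_norm] at h1
      have h2 := (hglob x hx).2 (s + t) (add_nonneg hs0 ht.1)
      calc ‖γ t‖ = ‖x.toFun (s + t) + (γ t - x.toFun (s + t))‖ := by congr 1; abel
        _ ≤ _ := (norm_add_le _ _).trans (add_le_add h2 h1)
    refine ⟨γ, hγ0, hγ, hR, fun hbξ => ?_⟩
    refine eqOn_Icc_of_contDiff hf (hξs.continuousOn.mono (hξs.Icc_subset le_rfl hbξ))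
      (fun t ht => hξs.hasDerivWithinAt_Ici le_rfl hbξ ht)
      (fun u hu => (hγ u hu).continuousWithinAt) (fun t ht => ?_) hγ0.symm
    rw [← hgf (by simpa using hR t (Ico_subset_Icc_self ht))]
    exact (hγ t (Ico_subset_Icc_self ht)).Ici_of_Icc Subset.rfl ht
  have hdom : ξ.dom = Ici 0 := by
    refine hξ.1.dom_eq_Ici hf (R := R) fun t ht => ?_
    have ht0 := hξs.2.1 ht
    obtain ⟨γ, -, -, hR, heq⟩ := hstep t ht0
    rw [heq ht ⟨ht0, le_rfl⟩]
    exact hR t ⟨ht0, le_rfl⟩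
  refine ⟨hdom, ?_⟩
  obtain ⟨γ, hγ0, hγ, -, heq⟩ := hstep T hT
  rw [heq (hdom ▸ hT) ⟨hT, le_rfl⟩, ← hγ0, ← dist_le_zero]
  refine le_of_forall_pos_le_add fun ε hε => ?_
  obtain ⟨r, hr⟩ := hper (ε / 3) (by positivity)
  obtain ⟨x, hx, s, -, hrs, h⟩ := key T hT γ hγ0 hγ (ε / 3 / Real.exp (K * T)) (by positivity) r
  have hexp : (1 : ℝ) ≤ Real.exp (K * T) := Real.one_le_exp (by positivity)
  have h1 := h T ⟨hT, le_rfl⟩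
  have h2 := h 0 ⟨le_rfl, hT⟩
  rw [div_mul_cancel₀ _ (Real.exp_ne_zero _)] at h1
  rw [mul_zero, Real.exp_zero, mul_one, add_zero, dist_comm] at h2
  have h3 := h2.trans (div_le_self (by positivity) hexp)
  have h4 := hr x hx s hrs
  rw [← dist_eq_norm] at h4
  linarith [dist_triangle4 (γ T) (x.toFun (s + T)) (x.toFun s) (γ 0)]

end ODE

/-! ### Exponential stability of the linearization and an adapted norm -/

section Linear

variable {Z : Type*} [NormedAddCommGroup Z] [NormedSpace ℝ Z]

lemma hasDerivAt_exp_smul_apply [CompleteSpace Z] (A : Z →L[ℝ] Z) (v : Z) (t : ℝ) :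
    HasDerivAt (fun s : ℝ => NormedSpace.exp (s • A) v) (A (NormedSpace.exp (t • A) v)) t :=
  (hasDerivAt_exp_smul_const' (𝕂 := ℝ) A t).clm_apply (hasDerivAt_const t v) |>.congr_deriv
    (by simp)

lemma exp_add_smul_apply [CompleteSpace Z] (A : Z →L[ℝ] Z) (v : Z) (s t : ℝ) :
    NormedSpace.exp ((s + t) • A) v = NormedSpace.exp (s • A) (NormedSpace.exp (t • A) v) := by
  have : NormedAlgebra ℚ (Z →L[ℝ] Z) := NormedAlgebra.restrictScalars ℚ ℝ _
  rw [add_smul, NormedSpace.exp_add_of_commute (((Commute.refl A).smul_left s).smul_right t)]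
  rfl

/-- Local exponential stability of an equilibrium of a `C¹` field passes to the linearization:
rescaled solutions starting at `z₀ + h v` converge, as `h → 0`, to `exp (t A) v`. -/
lemma norm_exp_smul_fderiv_apply_le [FiniteDimensional ℝ Z] {g : Z → Z} (hg : ContDiff ℝ 1 g)
    {z₀ : Z} (h0 : g z₀ = 0) {r c l : ℝ} (hr : 0 < r) (hc : 0 < c) (hl : 0 < l)
    (hst : ∀ z ∈ maxSolutions g (Metric.ball z₀ r), ∀ t ∈ z.dom,
      ‖z.toFun t - z₀‖ ≤ c * Real.exp (-l * t) * ‖z.toFun 0 - z₀‖) {b : ℝ} (hb : 0 ≤ b) (v : Z) :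
    ‖NormedSpace.exp (b • fderiv ℝ g z₀) v‖ ≤ c * Real.exp (-l * b) * ‖v‖ := by
  set A := fderiv ℝ g z₀ with hA
  set M : ℝ := gronwallBound 0 ‖A‖ 1 b with hM
  have hgb : ∀ ε, gronwallBound 0 ‖A‖ ε b = ε * M := by
    intro ε
    rw [hM]
    unfold gronwallBound
    split_ifs <;> ring
  refine le_of_forall_pos_le_add fun ε hε => ?_
  obtain ⟨κ, hκ, hκε⟩ : ∃ κ > 0, κ * (c * ‖v‖) * M ≤ ε := by
    refine ⟨ε / (c * ‖v‖ * |M| + 1), by positivity, ?_⟩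
    have h1 : ε / (c * ‖v‖ * |M| + 1) * (c * ‖v‖) * M ≤
        ε / (c * ‖v‖ * |M| + 1) * (c * ‖v‖) * |M| :=
      mul_le_mul_of_nonneg_left (le_abs_self M) (by positivity)
    refine h1.trans ?_
    rw [mul_assoc, div_mul_eq_mul_div, div_le_iff₀ (by positivity)]
    nlinarith [abs_nonneg M]
  have hd : HasFDerivAt g A z₀ := (hg.differentiable one_ne_zero z₀).hasFDerivAt
  obtain ⟨ρ, hρ, hρs⟩ : ∃ ρ > 0, ∀ z, ‖z - z₀‖ ≤ ρ → ‖g z - A (z - z₀)‖ ≤ κ * ‖z - z₀‖ := by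
    have := hd.isLittleO.def hκ
    obtain ⟨ρ, hρ, h⟩ := Metric.nhds_basis_closedBall.eventually_iff.1 this
    exact ⟨ρ, hρ, fun z hz => by simpa [h0] using h (by simpa [dist_eq_norm] using hz)⟩
  -- the scale of the perturbation of the equilibrium
  obtain ⟨h, hh, hh1, hh2⟩ : ∃ h > 0, h * ‖v‖ < r ∧ c * (h * ‖v‖) ≤ ρ := by
    refine ⟨min (r / (‖v‖ + 1)) (ρ / (c * (‖v‖ + 1))), by positivity, ?_, ?_⟩
    · calc _ ≤ r / (‖v‖ + 1) * ‖v‖ :=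
            mul_le_mul_of_nonneg_right (min_le_left _ _) (norm_nonneg _)
        _ < r := by
          rw [div_mul_eq_mul_div, div_lt_iff₀ (by positivity)]
          nlinarith
    · calc _ ≤ c * (ρ / (c * (‖v‖ + 1)) * ‖v‖) := by gcongr; exact min_le_right _ _
        _ = ρ * (‖v‖ / (‖v‖ + 1)) := by field_simp
        _ ≤ ρ := mul_le_of_le_one_right hρ.le (by rw [div_le_one (by positivity)]; linarith)
  obtain ⟨z, hz, hz0⟩ := exists_isMaximalSolution g (z₀ + h • v)
  have hzm : z ∈ maxSolutions g (Metric.ball z₀ r) :=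
    ⟨hz, by rw [hz0]; simpa [dist_eq_norm, norm_smul, abs_of_pos hh] using hh1⟩
  have hz1 : ∀ t ∈ z.dom, ‖z.toFun t - z₀‖ ≤ c * Real.exp (-l * t) * (h * ‖v‖) := by
    intro t ht
    have := hst z hzm t ht
    rw [hz0] at this
    simpa [norm_smul, abs_of_pos hh] using this
  have hz2 : ∀ t ∈ z.dom, ‖z.toFun t - z₀‖ ≤ c * (h * ‖v‖) := by
    intro t ht
    refine (hz1 t ht).trans ?_
    have : Real.exp (-l * t) ≤ 1 := Real.exp_le_one_iff.2 (by nlinarith [hz.1.2.1 ht, mem_Ici.1 (hz.1.2.1 ht)])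
    have h2 : c * Real.exp (-l * t) ≤ c := by nlinarith
    exact mul_le_mul_of_nonneg_right h2 (by positivity)
  have hdom : z.dom = Ici 0 := by
    refine hz.dom_eq_Ici hg (R := c * (h * ‖v‖) + ‖z₀‖) fun t ht => ?_
    calc ‖z.toFun t‖ = ‖(z.toFun t - z₀) + z₀‖ := by simp
      _ ≤ _ := (norm_add_le _ _).trans (add_le_add_left (hz2 t ht) _)
  have hmem : ∀ t, 0 ≤ t → t ∈ z.dom := fun t ht => by rw [hdom]; exact ht
  have hgr := dist_le_of_approx_trajectories_ODE (v := fun _ => A) (K := ‖A‖₊) (a := 0) (b := b)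
    (f := fun t => h⁻¹ • (z.toFun t - z₀)) (f' := fun t => h⁻¹ • g (z.toFun t))
    (g := fun t => NormedSpace.exp (t • A) v) (g' := fun t => A (NormedSpace.exp (t • A) v))
    (εf := κ * (c * ‖v‖)) (εg := 0) (δ := 0) (fun _ => A.lipschitz)
    (((hz.1.continuousOn.mono (hz.1.Icc_subset le_rfl (hmem b hb))).sub
      continuousOn_const).const_smul _)
    (fun t ht => ((hz.1.hasDerivWithinAt_Ici le_rfl (hmem b hb) ht).sub_const _).const_smul _)
    (fun t ht => by
      have h3 := hz2 t (hmem t ht.1)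
      have h4 := hρs _ (h3.trans hh2)
      rw [map_smul, dist_eq_norm, ← smul_sub, norm_smul, norm_inv, Real.norm_eq_abs, abs_of_pos hh]
      calc _ ≤ h⁻¹ * (κ * (c * (h * ‖v‖))) := by gcongr; exact h4.trans (by gcongr)
        _ = _ := by field_simp)
    (fun t _ => (hasDerivAt_exp_smul_apply A v t).continuousAt.continuousWithinAt)
    (fun t _ => (hasDerivAt_exp_smul_apply A v t).hasDerivWithinAt)
    (fun t _ => by simp)
    (by simp [hz0, smul_smul, hh.ne', NormedSpace.exp_zero])
    b ⟨hb, le_rfl⟩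
  rw [sub_zero, add_zero, coe_nnnorm, hgb, dist_eq_norm] at hgr
  have h5 : ‖h⁻¹ • (z.toFun b - z₀)‖ ≤ c * Real.exp (-l * b) * ‖v‖ := by
    rw [norm_smul, norm_inv, Real.norm_eq_abs, abs_of_pos hh]
    calc _ ≤ h⁻¹ * (c * Real.exp (-l * b) * (h * ‖v‖)) := by gcongr; exact hz1 b (hmem b hb)
      _ = _ := by field_simp
  calc ‖NormedSpace.exp (b • A) v‖
      = ‖h⁻¹ • (z.toFun b - z₀) -
        (h⁻¹ • (z.toFun b - z₀) - NormedSpace.exp (b • A) v)‖ := by congr 1; abel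
    _ ≤ _ := (norm_sub_le _ _).trans (add_le_add h5 (hgr.trans hκε))

/-- A norm, equivalent to the given one, in which `exp (t A)` contracts at the rate `l` without
overshoot. Besides this contraction only subadditivity and the equivalence with the given norm are
recorded. -/
structure IsAdaptedNorm (A : Z →L[ℝ] Z) (c l : ℝ) (N : Z → ℝ) : Prop where
  add_le : ∀ u v, N (u + v) ≤ N u + N v
  norm_le : ∀ v, ‖v‖ ≤ N v
  le_norm : ∀ v, N v ≤ c * ‖v‖
  exp_le : ∀ t ≥ 0, ∀ v, N (NormedSpace.exp (t • A) v) ≤ Real.exp (-l * t) * N v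

/-- The adapted norm is `N v = sup_{t ≥ 0} e^{l t} ‖exp (t A) v‖`. -/
lemma exists_isAdaptedNorm [CompleteSpace Z] {A : Z →L[ℝ] Z} {c l : ℝ}
    (h : ∀ t ≥ 0, ∀ v, ‖NormedSpace.exp (t • A) v‖ ≤ c * Real.exp (-l * t) * ‖v‖) :
    ∃ N, IsAdaptedNorm A c l N := by
  let φ : Z → NNReal → ℝ := fun v t => Real.exp (l * t) * ‖NormedSpace.exp ((t : ℝ) • A) v‖
  have hφ : ∀ v t, φ v t ≤ c * ‖v‖ := by
    intro v t
    calc φ v t ≤ Real.exp (l * t) * (c * Real.exp (-l * t) * ‖v‖) := by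
          simp only [φ]; gcongr; exact h t t.2 v
      _ = Real.exp (l * t) * Real.exp (-l * t) * (c * ‖v‖) := by ring
      _ = c * ‖v‖ := by rw [← Real.exp_add]; simp
  have hbdd : ∀ v, BddAbove (range (φ v)) := fun v => ⟨c * ‖v‖, by rintro _ ⟨t, rfl⟩; exact hφ v t⟩
  refine ⟨fun v => ⨆ t, φ v t, fun u v => ?_, fun v => ?_, fun v => ciSup_le (hφ v), fun t ht v => ?_⟩
  · refine ciSup_le fun t => ?_
    calc φ (u + v) t ≤ φ u t + φ v t := by
          simp only [φ, map_add, ← mul_add]; gcongr; exact norm_add_le _ _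
      _ ≤ _ := add_le_add (le_ciSup (hbdd u) t) (le_ciSup (hbdd v) t)
  · refine le_trans ?_ (le_ciSup (hbdd v) 0)
    simp [φ, NormedSpace.exp_zero]
  · refine ciSup_le fun s => ?_
    lift t to NNReal using ht
    have := le_ciSup (hbdd v) (s + t)
    refine le_trans (le_of_eq ?_) (mul_le_mul_of_nonneg_left this (Real.exp_pos _).le)
    simp only [φ, NNReal.coe_add]
    rw [exp_add_smul_apply, ← mul_assoc, ← Real.exp_add]
    congr 2
    ring

/-- A Grönwall inequality for perturbations of `y' = A y` in an adapted norm. -/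
lemma IsAdaptedNorm.le_of_perturbed [CompleteSpace Z] {A : Z →L[ℝ] Z} {c l : ℝ} {N : Z → ℝ}
    (hN : IsAdaptedNorm A c l N) (hc : 0 < c) (hl : 0 < l) {κ m : ℝ} (hκ : c * κ ≤ l / 2)
    (hκ0 : 0 ≤ κ) (hm : 0 ≤ m) {a b : ℝ} {y y' : ℝ → Z} (hy : ContinuousOn y (Icc a b))
    (hy' : ∀ t ∈ Ico a b, HasDerivWithinAt y (y' t) (Ici t) t)
    (hbound : ∀ t ∈ Ico a b, ‖y' t - A (y t)‖ ≤ κ * ‖y t‖ + m) :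
    ∀ t ∈ Icc a b, N (y t) ≤ Real.exp (-(l / 2) * (t - a)) * N (y a) + 2 * c * m / l := by
  have hNsub : ∀ u v, |N u - N v| ≤ c * ‖u - v‖ := by
    intro u v
    rw [abs_sub_le_iff]
    constructor
    · have h1 := hN.add_le v (u - v)
      rw [add_sub_cancel] at h1
      linarith [hN.le_norm (u - v)]
    · have h1 := hN.add_le u (v - u)
      rw [add_sub_cancel] at h1
      rw [norm_sub_rev]
      linarith [hN.le_norm (v - u)]
  have hNc : Continuous N := by
    refine (LipschitzWith.of_dist_le_mul (K := c.toNNReal) fun u v => ?_).continuous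
    rw [Real.dist_eq, dist_eq_norm, Real.coe_toNNReal _ hc.le]
    exact hNsub u v
  intro t ht
  have hmain := le_gronwallBound_of_liminf_deriv_right_le (f := fun t => N (y t))
    (f' := fun t => -l * N (y t) + c * ‖y' t - A (y t)‖) (δ := N (y a)) (K := -(l / 2))
    (ε := c * m) (hNc.comp_continuousOn hy) (fun x hx r hr => ?_) le_rfl (fun x hx => ?_) t ht
  · refine hmain.trans ?_
    rw [gronwallBound_of_K_ne_0 (by linarith)]
    have he : Real.exp (-(l / 2) * (t - a)) ≤ 1 :=
      Real.exp_le_one_iff.2 (by nlinarith [ht.1])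
    have he0 := Real.exp_pos (-(l / 2) * (t - a))
    have : c * m / -(l / 2) * (Real.exp (-(l / 2) * (t - a)) - 1) =
        2 * c * m / l * (1 - Real.exp (-(l / 2) * (t - a))) := by
      field_simp; ring
    dsimp only
    rw [this, mul_comm (N (y a))]
    have h2 : 0 ≤ 2 * c * m / l := by positivity
    nlinarith
  · refine Eventually.frequently ?_
    have hφ : HasDerivWithinAt (fun z => y z - NormedSpace.exp ((z - x) • A) (y x))
        (y' x - A (y x)) (Ici x) x := by
      have h1 : HasDerivAt (fun z : ℝ => NormedSpace.exp ((z - x) • A) (y x)) (A (y x)) x := by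
        have h2 := hasDerivAt_exp_smul_apply A (y x) (x - x)
        have := HasDerivAt.scomp (h := fun z : ℝ => z - x) x h2 ((hasDerivAt_id x).sub_const x)
        simpa [Function.comp_def, NormedSpace.exp_zero] using this
      exact (hy' x hx).sub h1.hasDerivWithinAt
    have hψ : HasDerivAt (fun z => Real.exp (-l * (z - x))) (-l) x := by
      have := (((hasDerivAt_id x).sub_const x).const_mul (-l)).exp
      simpa using this
    have t1 := (hasDerivWithinAt_iff_tendsto_slope.1 hφ).norm
    have t2 := hasDerivWithinAt_iff_tendsto_slope.1 (hψ.hasDerivWithinAt (s := Ici x))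
    rw [Ici_sdiff_left] at t1 t2
    have t3 := ((t2.mul_const (N (y x))).add (t1.const_mul c)).eventually_lt_const hr
    filter_upwards [t3, self_mem_nhdsWithin] with z hz hzx
    refine lt_of_le_of_lt ?_ hz
    have hzx' : 0 < z - x := sub_pos.2 hzx
    have h4 : N (y z) ≤ Real.exp (-l * (z - x)) * N (y x) +
        c * ‖y z - NormedSpace.exp ((z - x) • A) (y x)‖ := by
      have h5 := hN.add_le (NormedSpace.exp ((z - x) • A) (y x))
        (y z - NormedSpace.exp ((z - x) • A) (y x))
      rw [add_sub_cancel] at h5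
      linarith [hN.exp_le (z - x) hzx'.le (y x), hN.le_norm
        (y z - NormedSpace.exp ((z - x) • A) (y x))]
    simp only [slope, vsub_eq_sub, sub_self, zero_smul, NormedSpace.exp_zero, smul_eq_mul,
      mul_zero, Real.exp_zero, norm_smul, norm_inv, Real.norm_eq_abs, abs_of_pos hzx',
      one_apply_eq_self, sub_zero]
    calc (z - x)⁻¹ * (N (y z) - N (y x)) ≤ (z - x)⁻¹ * (Real.exp (-l * (z - x)) * N (y x) +
        c * ‖y z - NormedSpace.exp ((z - x) • A) (y x)‖ - N (y x)) := by gcongr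
      _ = _ := by ring
  · have h1 := hbound x hx
    have h2 := hN.norm_le (y x)
    have h3 : c * ‖y' x - A (y x)‖ ≤ c * (κ * N (y x) + m) := by
      gcongr
      exact h1.trans (by gcongr)
    have h4 : 0 ≤ N (y x) := (norm_nonneg _).trans h2
    nlinarith

end Linear

/-! ### Perturbations of an exponentially stable system by a small input -/

section Perturbation

variable {W Z : Type*} [NormedAddCommGroup Z] [NormedSpace ℝ Z]

/-- `z` solves `z' = f (w, z)` on `[a, b]`, with the input `w` given. -/
structure IsForcedSolution (f : W → Z → Z) (w : ℝ → W) (z : ℝ → Z) (a b : ℝ) : Prop where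
  continuousOn : ContinuousOn z (Icc a b)
  hasDerivWithinAt : ∀ t ∈ Ico a b, HasDerivWithinAt z (f (w t) (z t)) (Ici t) t

lemma IsForcedSolution.mono {f : W → Z → Z} {w : ℝ → W} {z : ℝ → Z} {a b a' b' : ℝ}
    (h : IsForcedSolution f w z a b) (ha : a ≤ a') (hb : b' ≤ b) :
    IsForcedSolution f w z a' b' :=
  ⟨h.continuousOn.mono (Icc_subset_Icc ha hb), fun t ht =>
    h.hasDerivWithinAt t ⟨ha.trans ht.1, ht.2.trans_le hb⟩⟩

/-- Continuous induction: a strict bound that follows at each time from its validity at all earlier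
times holds throughout. -/
lemma ContinuousOn.lt_of_forall_Ico {φ : ℝ → ℝ} {a b ρ : ℝ} (hφ : ContinuousOn φ (Icc a b))
    (h : ∀ t ∈ Icc a b, (∀ s ∈ Ico a t, φ s < ρ) → φ t < ρ) : ∀ t ∈ Icc a b, φ t < ρ := by
  by_contra! hne
  obtain ⟨t₁, ht₁, hρ⟩ := hne
  have hcl : IsClosed (Icc a b ∩ φ ⁻¹' Ici ρ) := hφ.preimage_isClosed_of_isClosed isClosed_Icc
    isClosed_Ici
  obtain ⟨t₀, ht₀, hmin⟩ := (isCompact_Icc.of_isClosed_subset hcl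
    inter_subset_left).exists_isLeast ⟨t₁, ht₁, hρ⟩
  refine (h t₀ ht₀.1 fun s hs => ?_).not_ge ht₀.2
  by_contra! hc
  exact hs.2.not_ge (hmin ⟨⟨hs.1, hs.2.le.trans ht₀.1.2⟩, hc⟩)

variable [NormedAddCommGroup W]

/-- The data near the equilibrium `z₀` on which trapping and contraction rest: for inputs of size
at most `ε`, the field is `κ`-close to linear on the `ρ`-ball and of size at most `m` at `z₀`. -/
structure IsNearlyLinear (f : W → Z → Z) (A : Z →L[ℝ] Z) (z₀ : Z) (κ m ρ ε : ℝ) : Prop where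
  sub_le : ∀ w, ‖w‖ ≤ ε → ∀ z₁ ∈ Metric.closedBall z₀ ρ, ∀ z₂ ∈ Metric.closedBall z₀ ρ,
    ‖f w z₁ - f w z₂ - A (z₁ - z₂)‖ ≤ κ * ‖z₁ - z₂‖
  center_le : ∀ w, ‖w‖ ≤ ε → ‖f w z₀‖ ≤ m

/-- Trajectories with small inputs that start well inside the `ρ`-ball around `z₀` never leave it:
as long as they are inside, the adapted norm of `z - z₀` stays below `ρ / 2`. -/
lemma IsNearlyLinear.trapping [CompleteSpace Z] {f : W → Z → Z} {A : Z →L[ℝ] Z} {z₀ : Z}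
    {κ m ρ ε c l : ℝ} {N : Z → ℝ} (hf : IsNearlyLinear f A z₀ κ m ρ ε)
    (hN : IsAdaptedNorm A c l N) (hc : 0 < c) (hl : 0 < l) (hκ : c * κ ≤ l / 2) (hκ0 : 0 ≤ κ)
    (hm0 : 0 ≤ m) (hρ : 0 < ρ) (hm : 2 * c * m / l ≤ ρ / 4) {w : ℝ → W} {z : ℝ → Z} {a b : ℝ}
    (hw : ∀ t ∈ Icc a b, ‖w t‖ ≤ ε) (hz : IsForcedSolution f w z a b)
    (ha : c * ‖z a - z₀‖ ≤ ρ / 4) : ∀ t ∈ Icc a b, ‖z t - z₀‖ < ρ := by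
  refine ContinuousOn.lt_of_forall_Ico (hz.continuousOn.sub continuousOn_const).norm
    fun t ht hs => ?_
  have hIco : ∀ s ∈ Ico a t, s ∈ Icc a b := fun s hs => ⟨hs.1, hs.2.le.trans ht.2⟩
  have h1 := hN.le_of_perturbed hc hl hκ hκ0 hm0 (y := fun s => z s - z₀) (a := a) (b := t)
    ((hz.mono le_rfl ht.2).continuousOn.sub continuousOn_const)
    (fun s hs => ((hz.mono le_rfl ht.2).hasDerivWithinAt s hs).sub_const z₀)
    (fun s hs' => by
      have h2 := hf.sub_le (w s) (hw s (hIco s hs')) (z s)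
        (by simpa [dist_eq_norm] using (hs s hs').le) z₀ (by simpa using hρ.le)
      have h3 := hf.center_le (w s) (hw s (hIco s hs'))
      calc ‖f (w s) (z s) - A (z s - z₀)‖
          = ‖(f (w s) (z s) - f (w s) z₀ - A (z s - z₀)) + f (w s) z₀‖ := by congr 1; abel
        _ ≤ _ := (norm_add_le _ _).trans (add_le_add h2 h3)) t ⟨ht.1, le_rfl⟩
  have h4 : Real.exp (-(l / 2) * (t - a)) ≤ 1 :=
    Real.exp_le_one_iff.2 (by nlinarith [ht.1])
  have h5 : Real.exp (-(l / 2) * (t - a)) * N (z a - z₀) ≤ N (z a - z₀) :=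
    mul_le_of_le_one_left ((norm_nonneg _).trans (hN.norm_le _)) h4
  linarith [hN.norm_le (z t - z₀), hN.le_norm (z a - z₀)]

/-- Two trajectories in the nearly linear region, driven by inputs with nearly equal effect,
approach each other exponentially up to the size of the discrepancy. -/
lemma IsNearlyLinear.contraction [CompleteSpace Z] {f : W → Z → Z} {A : Z →L[ℝ] Z} {z₀ : Z}
    {κ m ρ ε c l : ℝ} {N : Z → ℝ} (hf : IsNearlyLinear f A z₀ κ m ρ ε)
    (hN : IsAdaptedNorm A c l N) (hc : 0 < c) (hl : 0 < l) (hκ : c * κ ≤ l / 2) (hκ0 : 0 ≤ κ)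
    {w₁ w₂ : ℝ → W} {z₁ z₂ : ℝ → Z} {a b μ : ℝ} (hab : a ≤ b) (hμ : 0 ≤ μ)
    (hw₁ : ∀ t ∈ Icc a b, ‖w₁ t‖ ≤ ε)
    (hz₁ : IsForcedSolution f w₁ z₁ a b) (hz₂ : IsForcedSolution f w₂ z₂ a b)
    (hb₁ : ∀ t ∈ Icc a b, z₁ t ∈ Metric.closedBall z₀ ρ)
    (hb₂ : ∀ t ∈ Icc a b, z₂ t ∈ Metric.closedBall z₀ ρ)
    (hd : ∀ t ∈ Icc a b, ‖f (w₁ t) (z₂ t) - f (w₂ t) (z₂ t)‖ ≤ μ) :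
    ‖z₁ b - z₂ b‖ ≤ c * Real.exp (-(l / 2) * (b - a)) * ‖z₁ a - z₂ a‖ + 2 * c * μ / l := by
  have h1 := hN.le_of_perturbed hc hl hκ hκ0 hμ (y := fun s => z₁ s - z₂ s) (a := a) (b := b)
    (hz₁.continuousOn.sub hz₂.continuousOn)
    (fun s hs => (hz₁.hasDerivWithinAt s hs).sub (hz₂.hasDerivWithinAt s hs))
    (fun s hs => by
      have hs' := Ico_subset_Icc_self hs
      have h2 := hf.sub_le (w₁ s) (hw₁ s hs') (z₁ s) (hb₁ s hs') (z₂ s) (hb₂ s hs')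
      calc _ = ‖(f (w₁ s) (z₁ s) - f (w₁ s) (z₂ s) - A (z₁ s - z₂ s)) +
            (f (w₁ s) (z₂ s) - f (w₂ s) (z₂ s))‖ := by congr 1; abel
        _ ≤ _ := (norm_add_le _ _).trans (add_le_add h2 (hd s hs'))) b ⟨hab, le_rfl⟩
  refine (hN.norm_le _).trans (h1.trans ?_)
  have h6 := mul_le_mul_of_nonneg_left (hN.le_norm (z₁ a - z₂ a))
    (Real.exp_pos (-(l / 2) * (b - a))).le
  linarith

/-- Continuity of the derivative in the state at `(0, z₀)` makes the perturbed fields nearly linear.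
The radius `ρ` depends on `κ` only, so that `m` may be chosen small relative to it. -/
lemma eventually_isNearlyLinear {ι : Type*} {L : Filter ι} {g : ι → W → Z → Z}
    {A : Z →L[ℝ] Z} {z₀ : Z} (hg : ∀ i w, Differentiable ℝ (g i w))
    (hlim : Tendsto (fun p : ι × W × Z => g p.1 p.2.1 p.2.2) (L ×ˢ 𝓝 (0, z₀)) (𝓝 0))
    (hlim' : Tendsto (fun p : ι × W × Z => fderiv ℝ (g p.1 p.2.1) p.2.2) (L ×ˢ 𝓝 (0, z₀)) (𝓝 A))
    {κ : ℝ} (hκ : 0 < κ) : ∃ ρ > 0, ∀ m > 0, ∃ ε > 0, ∀ᶠ i in L,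
      IsNearlyLinear (g i) A z₀ κ m ρ ε := by
  have h1 : ∀ᶠ p : ι × W × Z in L ×ˢ 𝓝 (0, z₀), ‖fderiv ℝ (g p.1 p.2.1) p.2.2 - A‖ ≤ κ := by
    filter_upwards [hlim'.eventually (Metric.closedBall_mem_nhds A hκ)] with p hp
    simpa [dist_eq_norm] using hp
  have hbasis : ∀ {P : ι × W × Z → Prop}, (∀ᶠ p in L ×ˢ 𝓝 ((0 : W), z₀), P p) →
      ∃ r > 0, ∀ᶠ i in L, ∀ w, ‖w‖ ≤ r → ∀ z, ‖z - z₀‖ ≤ r → P (i, w, z) := by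
    intro P hP
    obtain ⟨pa, ha, pb, hb, hab⟩ := eventually_prod_iff.1 hP
    obtain ⟨r, hr, h⟩ := Metric.nhds_basis_closedBall.eventually_iff.1 hb
    refine ⟨r, hr, ?_⟩
    filter_upwards [ha] with i hi w hw z hz
    refine hab hi (h ?_)
    rw [Metric.mem_closedBall, Prod.dist_eq, max_le_iff]
    exact ⟨by simpa using hw, by simpa [dist_eq_norm] using hz⟩
  obtain ⟨ρ, hρ, hρs⟩ := hbasis h1
  refine ⟨ρ, hρ, fun m hm => ?_⟩
  have h2 : ∀ᶠ p : ι × W × Z in L ×ˢ 𝓝 (0, z₀), ‖g p.1 p.2.1 p.2.2‖ ≤ m := by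
    filter_upwards [hlim.eventually (Metric.closedBall_mem_nhds 0 hm)] with p hp
    simpa using hp
  obtain ⟨ε, hε, hεs⟩ := hbasis h2
  refine ⟨min ρ ε, by positivity, ?_⟩
  filter_upwards [hρs, hεs] with i hi1 hi2
  refine ⟨fun w hw z₁ hz₁ z₂ hz₂ => ?_, fun w hw => ?_⟩
  · exact (convex_closedBall z₀ ρ).norm_image_sub_le_of_norm_hasFDerivWithin_le'
      (fun z _ => (hg i w z).hasFDerivAt.hasFDerivWithinAt)
      (fun z hz => hi1 w (hw.trans (min_le_left _ _)) z (by simpa [dist_eq_norm] using hz))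
      hz₂ hz₁
  · exact hi2 w (hw.trans (min_le_right _ _)) z₀ (by simpa using hε.le)

/-- Continuous dependence near one nominal trajectory on a compact time interval: perturbed
trajectories with close initial value and small input follow it. -/
lemma eventually_forcedSolution_near [FiniteDimensional ℝ Z] {ι : Type*} {L : Filter ι}
    {g : ι → W → Z → Z} {g₀ : Z → Z} (hg₀ : ContDiff ℝ 1 g₀) {O : Set Z} (hO : IsOpen O)
    (hlim : ∀ z ∈ O, Tendsto (fun p : ι × W × Z => g p.1 p.2.1 p.2.2) (L ×ˢ 𝓝 (0, z))
      (𝓝 (g₀ z))) {γ : ℝ → Z} {τ : ℝ} (hγ : ContinuousOn γ (Icc 0 τ))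
    (hγ' : ∀ t ∈ Ico 0 τ, HasDerivWithinAt γ (g₀ (γ t)) (Ici t) t)
    (hγO : ∀ t ∈ Icc 0 τ, γ t ∈ O) {σ : ℝ} (hσ : 0 < σ) :
    ∃ δ > 0, ∃ ε > 0, ∀ᶠ i in L, ∀ (w : ℝ → W) (z : ℝ → Z) (b : ℝ), b ≤ τ →
      (∀ t ∈ Icc 0 b, ‖w t‖ ≤ ε) → IsForcedSolution (g i) w z 0 b → ‖z 0 - γ 0‖ < δ →
      ∀ t ∈ Icc 0 b, ‖z t - γ t‖ < σ := by
  have hK₀ : IsCompact (γ '' Icc 0 τ) := isCompact_Icc.image_of_continuousOn hγ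
  obtain ⟨θ, hθ, hθO⟩ := hK₀.exists_cthickening_subset_open hO
    (image_subset_iff.2 fun t ht => hγO t ht)
  set K₁ := Metric.cthickening θ (γ '' Icc 0 τ) with hK₁
  have hK₁c : IsCompact K₁ := hK₀.cthickening
  obtain ⟨B, hB⟩ := hK₁c.isBounded.subset_closedBall 0
  obtain ⟨Λ, hΛ⟩ := (hg₀.contDiffOn (s := Metric.closedBall 0 B)).exists_lipschitzOnWith
    one_ne_zero (convex_closedBall 0 B) (isCompact_closedBall 0 B)
  -- the discrepancy of the fields is uniformly small on the tube `K₁`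
  have hunif : ∀ μ > 0, ∃ ε > 0, ∀ᶠ i in L, ∀ w, ‖w‖ ≤ ε → ∀ z ∈ K₁, ‖g i w z - g₀ z‖ ≤ μ := by
    intro μ hμ
    have h1 : ∀ z ∈ K₁, ∀ᶠ p : (ι × W) × Z in (L ×ˢ 𝓝 0) ×ˢ 𝓝 z,
        ‖g p.1.1 p.1.2 p.2 - g₀ p.2‖ ≤ μ := by
      intro z hz
      have h2 : Tendsto (fun p : ι × W × Z => g p.1 p.2.1 p.2.2 - g₀ p.2.2) (L ×ˢ 𝓝 (0, z))
          (𝓝 (g₀ z - g₀ z)) := by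
        refine (hlim z (hθO hz)).sub ?_
        refine (hg₀.continuous.tendsto z).comp ?_
        rw [nhds_prod_eq]
        exact tendsto_snd.comp tendsto_snd
      rw [sub_self] at h2
      have h3 := h2.eventually (Metric.closedBall_mem_nhds 0 hμ)
      rw [nhds_prod_eq, ← prod_assoc, eventually_map] at h3
      filter_upwards [h3] with p hp
      simpa using hp
    have h2 : ∀ᶠ p : (ι × W) × Z in (L ×ˢ 𝓝 0) ×ˢ 𝓝ˢ K₁, ‖g p.1.1 p.1.2 p.2 - g₀ p.2‖ ≤ μ := by
      exact hK₁c.mem_prod_nhdsSet_of_forall h1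
    obtain ⟨pa, ha, pb, hb, hab⟩ := eventually_prod_iff.1 h2
    obtain ⟨pc, hc, pd, hd, hcd⟩ := eventually_prod_iff.1 ha
    obtain ⟨ε, hε, h⟩ := Metric.nhds_basis_closedBall.eventually_iff.1 hd
    refine ⟨ε, hε, ?_⟩
    filter_upwards [hc] with i hi w hw z hz
    exact hab (hcd hi (h (by simpa using hw))) (hb.self_of_nhdsSet z hz)
  have hσθ : 0 < min σ θ := lt_min hσ hθ
  -- `δ` and `μ` make the Grönwall bound over `[0, τ]` smaller than `min σ θ`
  have hcont : Tendsto (fun δ : ℝ => gronwallBound δ Λ δ (max τ 0)) (𝓝[>] 0) (𝓝 0) := by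
    have : Continuous fun δ : ℝ => gronwallBound δ Λ δ (max τ 0) := by
      unfold gronwallBound
      split_ifs <;> fun_prop
    have h := this.tendsto 0
    rw [gronwallBound_ε0_δ0] at h
    exact h.mono_left nhdsWithin_le_nhds
  obtain ⟨δ, hδσ, hδ⟩ := ((hcont.eventually_lt_const hσθ).and self_mem_nhdsWithin).exists
  have hδ : 0 < δ := hδ
  obtain ⟨ε, hε, hev⟩ := hunif δ hδ
  refine ⟨δ, hδ, ε, hε, ?_⟩
  filter_upwards [hev] with i hi w z b hb hw hz h0
  have hmain : ∀ t ∈ Icc 0 b, ‖z t - γ t‖ < min σ θ := by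
    refine ContinuousOn.lt_of_forall_Ico
      (hz.continuousOn.sub (hγ.mono (Icc_subset_Icc_right hb))).norm fun t ht hs => ?_
    have htτ : t ≤ τ := ht.2.trans hb
    have hγK : ∀ s ∈ Ico 0 t, γ s ∈ K₁ := fun s hs' =>
      Metric.self_subset_cthickening _ (mem_image_of_mem _ ⟨hs'.1, hs'.2.le.trans htτ⟩)
    have hzK : ∀ s ∈ Ico 0 t, z s ∈ K₁ := fun s hs' =>
      Metric.mem_cthickening_of_dist_le (z s) (γ s) θ _
        (mem_image_of_mem _ ⟨hs'.1, hs'.2.le.trans htτ⟩)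
        (by rw [dist_eq_norm]; exact (hs s hs').le.trans (min_le_right _ _))
    have h1 := dist_le_of_approx_trajectories_ODE_of_mem (v := fun _ => g₀)
      (s := fun _ => Metric.closedBall 0 B) (K := Λ) (a := 0) (b := t) (f := z) (g := γ)
      (f' := fun s => g i (w s) (z s)) (g' := fun s => g₀ (γ s)) (εf := δ) (εg := 0) (δ := δ)
      (fun _ _ => hΛ) (hz.mono le_rfl ht.2).continuousOn (hz.mono le_rfl ht.2).hasDerivWithinAt
      (fun s hs' => by
        rw [dist_eq_norm]
        exact hi (w s) (hw s ⟨hs'.1, hs'.2.le.trans ht.2⟩) (z s) (hzK s hs'))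
      (fun s hs' => hB (hzK s hs')) (hγ.mono (Icc_subset_Icc_right htτ))
      (fun s hs' => hγ' s ⟨hs'.1, hs'.2.trans_le htτ⟩) (fun s _ => by simp)
      (fun s hs' => hB (hγK s hs')) (by rw [dist_eq_norm]; exact h0.le) t ⟨ht.1, le_rfl⟩
    rw [dist_eq_norm, add_zero, sub_zero] at h1
    exact h1.trans_lt ((gronwallBound_mono hδ.le hδ.le Λ.2 (htτ.trans (le_max_left _ _))).trans_lt
      hδσ)
  exact fun t ht => (hmain t ht).trans_le (min_le_left _ _)

/-- Robust uniform attraction: perturbed trajectories starting near `Z₀` with small inputs are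
bounded uniformly, enter a ball around the nominal equilibrium before a common time and stay
there, and in this ball trajectories with asymptotically equal inputs approach each other. -/
lemma exists_uniform_attraction [FiniteDimensional ℝ Z] {ι : Type*} {L : Filter ι}
    {g : ι → W → Z → Z} (hg : ∀ i w, Differentiable ℝ (g i w)) {g₀ : Z → Z}
    (hg₀ : ContDiff ℝ 1 g₀) {z₀ : Z} {Z₀ : Set Z} (hZ₀ : IsCompact Z₀)
    (hles : LocallyExpStableAttracting g₀ z₀ Z₀) {O : Set Z} (hO : IsOpen O) (hz₀O : z₀ ∈ O)
    (hsolO : ∀ z ∈ maxSolutions g₀ Z₀, ∀ t ∈ z.dom, z.toFun t ∈ O)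
    (hlim : ∀ z ∈ O, Tendsto (fun p : ι × W × Z => g p.1 p.2.1 p.2.2) (L ×ˢ 𝓝 (0, z))
      (𝓝 (g₀ z)))
    (hlim' : Tendsto (fun p : ι × W × Z => fderiv ℝ (g p.1 p.2.1) p.2.2) (L ×ˢ 𝓝 (0, z₀))
      (𝓝 (fderiv ℝ g₀ z₀))) :
    ∃ V ∈ 𝓝ˢ Z₀, ∃ ε > 0, ∃ R τ ρ : ℝ, ∃ c > 0, ∃ l > 0, ∀ᶠ i in L,
      (∀ (w : ℝ → W) (z : ℝ → Z) (b : ℝ), (∀ t ∈ Icc 0 b, ‖w t‖ ≤ ε) →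
        IsForcedSolution (g i) w z 0 b → z 0 ∈ V →
        ∀ t ∈ Icc 0 b, ‖z t‖ ≤ R ∧ (τ ≤ t → z t ∈ Metric.closedBall z₀ ρ)) ∧
      (∀ (w₁ w₂ : ℝ → W) (z₁ z₂ : ℝ → Z) (a b μ : ℝ), a ≤ b → 0 ≤ μ →
        (∀ t ∈ Icc a b, ‖w₁ t‖ ≤ ε) →
        IsForcedSolution (g i) w₁ z₁ a b → IsForcedSolution (g i) w₂ z₂ a b →
        (∀ t ∈ Icc a b, z₁ t ∈ Metric.closedBall z₀ ρ) →
        (∀ t ∈ Icc a b, z₂ t ∈ Metric.closedBall z₀ ρ) →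
        (∀ t ∈ Icc a b, ‖g i (w₁ t) (z₂ t) - g i (w₂ t) (z₂ t)‖ ≤ μ) →
        ‖z₁ b - z₂ b‖ ≤ c * Real.exp (-l * (b - a)) * ‖z₁ a - z₂ a‖ + c * μ) := by
  obtain ⟨h0, ⟨r, hr, c, hc, l, hl, hst⟩, hattr⟩ := hles
  set A := fderiv ℝ g₀ z₀ with hA
  obtain ⟨N, hN⟩ := exists_isAdaptedNorm (A := A) (c := c) (l := l) fun t ht v =>
    norm_exp_smul_fderiv_apply_le hg₀ h0 hr hc hl hst ht v
  -- `κ` halves the decay rate, `m` keeps the offset below a quarter of the trapping radius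
  have hκ : 0 < l / (2 * c) := by positivity
  have hκ' : c * (l / (2 * c)) ≤ l / 2 := le_of_eq (by field_simp)
  obtain ⟨ρ, hρ, hm⟩ := eventually_isNearlyLinear hg (h0 ▸ hlim z₀ hz₀O) hlim' hκ
  have hm0 : 0 < l * ρ / (8 * c) := by positivity
  have hm' : 2 * c * (l * ρ / (8 * c)) / l ≤ ρ / 4 := le_of_eq (by field_simp; norm_num)
  obtain ⟨ε₀, hε₀, hlin⟩ := hm _ hm0
  obtain ⟨V, hV, ε, hε, R, τ, hev⟩ : ∃ V ∈ 𝓝ˢ Z₀, ∃ ε > 0, ∃ R τ : ℝ, ∀ᶠ i in L,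
      ∀ (w : ℝ → W) (z : ℝ → Z) (b : ℝ), (∀ t ∈ Icc 0 b, ‖w t‖ ≤ ε) →
        IsForcedSolution (g i) w z 0 b → z 0 ∈ V →
        ∀ t ∈ Icc 0 b, ‖z t‖ ≤ R ∧ (τ ≤ t → z t ∈ Metric.closedBall z₀ ρ) := by
    let P : Set Z → Prop := fun S => ∃ V ∈ 𝓝ˢ S, ∃ ε > 0, ∃ R τ : ℝ, ∀ᶠ i in L,
      ∀ (w : ℝ → W) (z : ℝ → Z) (b : ℝ), (∀ t ∈ Icc 0 b, ‖w t‖ ≤ ε) →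
        IsForcedSolution (g i) w z 0 b → z 0 ∈ V →
        ∀ t ∈ Icc 0 b, ‖z t‖ ≤ R ∧ (τ ≤ t → z t ∈ Metric.closedBall z₀ ρ)
    refine hZ₀.induction_on (p := P) ?_ ?_ ?_ ?_
    · exact ⟨∅, by simp, 1, one_pos, 0, 0, by simp⟩
    · rintro S S' hS ⟨V, hV, h⟩
      exact ⟨V, nhdsSet_mono hS hV, h⟩
    · rintro S S' ⟨V, hV, ε, hε, R, τ, h⟩ ⟨V', hV', ε', hε', R', τ', h'⟩
      refine ⟨V ∪ V', union_mem_nhdsSet hV hV', min ε ε', lt_min hε hε', max R R', max τ τ', ?_⟩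
      filter_upwards [h, h'] with i hi hi' w z b hw hz h0 t ht
      rcases h0 with h0 | h0
      · have := hi w z b (fun t ht => (hw t ht).trans (min_le_left _ _)) hz h0 t ht
        exact ⟨this.1.trans (le_max_left _ _), fun h => this.2 ((le_max_left _ _).trans h)⟩
      · have := hi' w z b (fun t ht => (hw t ht).trans (min_le_right _ _)) hz h0 t ht
        exact ⟨this.1.trans (le_max_right _ _), fun h => this.2 ((le_max_right _ _).trans h)⟩
    · intro p hp
      obtain ⟨ζ, hζ, hζ0⟩ := exists_isMaximalSolution g₀ p
      have hζm : ζ ∈ maxSolutions g₀ Z₀ := ⟨hζ, by rwa [hζ0]⟩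
      obtain ⟨hdom, htend⟩ := hattr ζ hζm
      -- half of the admissible entrance radius is left for the nominal trajectory
      set σ : ℝ := ρ / (8 * c) with hσ
      have hσ0 : 0 < σ := by positivity
      obtain ⟨τ, hτ, hτ0⟩ := ((htend.eventually (Metric.ball_mem_nhds z₀ hσ0)).and
        (eventually_ge_atTop 0)).exists
      have hτd : τ ∈ ζ.dom := by rw [hdom]; exact hτ0
      have hζc : ContinuousOn ζ.toFun (Icc 0 τ) :=
        hζ.1.continuousOn.mono (hζ.1.Icc_subset le_rfl hτd)
      obtain ⟨δ, hδ, ε₁, hε₁, hev⟩ := eventually_forcedSolution_near hg₀ hO hlim hζc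
        (fun t ht => hζ.1.hasDerivWithinAt_Ici le_rfl hτd ht)
        (fun t ht => hsolO ζ hζm t (hζ.1.Icc_subset le_rfl hτd ht)) hσ0
      obtain ⟨B, hB⟩ := (isCompact_Icc.image_of_continuousOn hζc).isBounded.exists_norm_le
      refine ⟨Metric.ball p δ, mem_nhdsWithin_of_mem_nhds (Metric.ball_mem_nhds p hδ),
        Metric.ball p δ, Metric.isOpen_ball.mem_nhdsSet_self, min ε₁ ε₀, lt_min hε₁ hε₀,
        max (B + σ) (‖z₀‖ + ρ), τ, ?_⟩
      filter_upwards [hev, hlin] with i hi hili w z b hw hz hz0 t ht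
      have hz0' : ‖z 0 - ζ.toFun 0‖ < δ := by rw [hζ0]; simpa [dist_eq_norm] using hz0
      have hearly : ∀ s ∈ Icc 0 b, s ≤ τ → ‖z s - ζ.toFun s‖ < σ := fun s hs hsτ =>
        hi w z s hsτ (fun u hu => (hw u ⟨hu.1, hu.2.trans hs.2⟩).trans (min_le_left _ _))
          (hz.mono le_rfl hs.2) hz0' s ⟨hs.1, le_rfl⟩
      have hlate : τ ≤ t → z t ∈ Metric.closedBall z₀ ρ := by
        intro hτt
        have h1 := hearly τ ⟨hτ0, hτt.trans ht.2⟩ le_rfl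
        have h2 : ‖z τ - z₀‖ ≤ σ + σ := by
          rw [dist_eq_norm] at hτ
          calc ‖z τ - z₀‖ = ‖(z τ - ζ.toFun τ) + (ζ.toFun τ - z₀)‖ := by congr 1; abel
            _ ≤ _ := (norm_add_le _ _).trans (add_le_add h1.le hτ.le)
        have h3 : c * ‖z τ - z₀‖ ≤ ρ / 4 := by
          calc c * ‖z τ - z₀‖ ≤ c * (σ + σ) := by gcongr
            _ = ρ / 4 := by rw [hσ]; field_simp; norm_num
        have h4 := hili.trapping hN hc hl hκ' hκ.le hm0.le hρ hm' (a := τ) (b := b) (w := w)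
          (fun u hu => (hw u ⟨hτ0.trans hu.1, hu.2⟩).trans (min_le_right _ _))
          (hz.mono hτ0 le_rfl) h3 t ⟨hτt, ht.2⟩
        rw [Metric.mem_closedBall, dist_eq_norm]
        exact h4.le
      refine ⟨?_, hlate⟩
      rcases le_total t τ with h | h
      · refine le_trans ?_ (le_max_left _ _)
        calc ‖z t‖ = ‖ζ.toFun t + (z t - ζ.toFun t)‖ := by congr 1; abel
          _ ≤ _ := (norm_add_le _ _).trans (add_le_add
            (hB _ (mem_image_of_mem _ ⟨ht.1, h⟩)) (hearly t ht h).le)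
      · refine le_trans ?_ (le_max_right _ _)
        have := hlate h
        rw [Metric.mem_closedBall, dist_eq_norm] at this
        calc ‖z t‖ = ‖z₀ + (z t - z₀)‖ := by congr 1; abel
          _ ≤ _ := (norm_add_le _ _).trans (add_le_add le_rfl this)
  refine ⟨V, hV, min ε ε₀, lt_min hε hε₀, R, τ, ρ, max c (2 * c / l), lt_max_of_lt_left hc, l / 2,
    by positivity, ?_⟩
  filter_upwards [hev, hlin] with i hi hili
  refine ⟨fun w z b hw hz h0 => hi w z b (fun t ht => (hw t ht).trans (min_le_left _ _)) hz h0,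
    fun w₁ w₂ z₁ z₂ a b μ hab hμ hw₁ hz₁ hz₂ hb₁ hb₂ hd => ?_⟩
  refine (hili.contraction hN hc hl hκ' hκ.le hab hμ
    (fun t ht => (hw₁ t ht).trans (min_le_right _ _)) hz₁ hz₂ hb₁ hb₂ hd).trans ?_
  have e1 : 2 * c * μ / l = 2 * c / l * μ := by ring
  rw [e1]
  gcongr
  · exact le_max_left _ _
  · exact le_max_right _ _

end Perturbation

/-! ### Convergence of the controlled plant in the weak `C²` topology -/

section Convergence

lemma TendstoUniformlyOn.tendsto_prod_nhds {ι P M : Type*} [TopologicalSpace P]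
    [PseudoMetricSpace M] {L : Filter ι} {Φ : ι → P → M} {Φ₀ : P → M} {S : Set P}
    (h : TendstoUniformlyOn Φ Φ₀ L S) {p₀ : P} (hS : S ∈ 𝓝 p₀) (hc : ContinuousAt Φ₀ p₀) :
    Tendsto (fun q : ι × P => Φ q.1 q.2) (L ×ˢ 𝓝 p₀) (𝓝 (Φ₀ p₀)) := by
  rw [Metric.tendsto_nhds]
  intro ε hε
  have h1 := Metric.tendstoUniformlyOn_iff.1 h (ε / 2) (by positivity)
  have h2 := Metric.continuousAt_iff'.1 hc (ε / 2) (by positivity)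
  filter_upwards [h1.prod_mk (h2.and hS)] with q hq
  have := hq.1 q.2 hq.2.2
  rw [dist_comm] at this
  linarith [hq.2.1, dist_triangle (Φ q.1 q.2) (Φ₀ q.2) (Φ₀ p₀)]

variable {W X U Y : Type*} [NormedAddCommGroup W] [NormedSpace ℝ W]
  [NormedAddCommGroup X] [NormedSpace ℝ X] [NormedAddCommGroup U] [NormedSpace ℝ U]
  [NormedAddCommGroup Y] [NormedSpace ℝ Y]

lemma eventually_weakC2Edist_lt (Pb : Set ((W × X) × U))
    (Fp : Set (((W × X) × U → X) × (W × X → Y))) (F₀ : Fp) {ε : ENNReal} (hε : 0 < ε) :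
    ∀ᶠ F in @nhds _ (weakC2Topology Pb Fp) F₀, weakC2Edist Pb F.1 F₀.1 < ε := by
  let _ := weakC2PseudoEMetric Pb Fp
  exact Metric.eball_mem_nhds F₀ hε

lemma tendstoUniformlyOn_jointMap (Pb : Set ((W × X) × U))
    (Fp : Set (((W × X) × U → X) × (W × X → Y))) (F₀ : Fp) :
    TendstoUniformlyOn (fun F : Fp => jointMap F.1) (jointMap F₀.1)
      (@nhds _ (weakC2Topology Pb Fp) F₀) Pb := by
  rw [EMetric.tendstoUniformlyOn_iff]
  intro ε hε
  filter_upwards [eventually_weakC2Edist_lt Pb Fp F₀ hε] with F hF p hp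
  refine lt_of_le_of_lt ?_ hF
  refine le_trans (le_of_eq ?_) (le_iSup_of_le (0 : Fin 3) (le_iSup₂_of_le p hp le_rfl))
  rw [edist_comm, edist_dist, edist_dist]
  congr 1
  have := dist_iteratedFDerivWithin_zero (𝕜 := ℝ) (jointMap F.1) univ p (jointMap F₀.1) univ p
  simpa [iteratedFDerivWithin_univ] using this.symm

lemma tendstoUniformlyOn_fderiv_jointMap (Pb : Set ((W × X) × U))
    (Fp : Set (((W × X) × U → X) × (W × X → Y))) (F₀ : Fp) :
    TendstoUniformlyOn (fun F : Fp => fderiv ℝ (jointMap F.1)) (fderiv ℝ (jointMap F₀.1))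
      (@nhds _ (weakC2Topology Pb Fp) F₀) Pb := by
  rw [EMetric.tendstoUniformlyOn_iff]
  intro ε hε
  filter_upwards [eventually_weakC2Edist_lt Pb Fp F₀ hε] with F hF p hp
  refine lt_of_le_of_lt ?_ hF
  refine le_trans (le_of_eq ?_) (le_iSup_of_le (1 : Fin 3) (le_iSup₂_of_le p hp le_rfl))
  rw [edist_comm, edist_dist, edist_dist]
  congr 1
  have := dist_iteratedFDerivWithin_one (𝕜 := ℝ) (x := p) (jointMap F.1) (jointMap F₀.1)
    uniqueDiffWithinAt_univ (y := p) uniqueDiffWithinAt_univ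
  simpa [iteratedFDerivWithin_univ, fderivWithin_univ] using this.symm

variable {C : Type*} [NormedAddCommGroup C] [NormedSpace ℝ C]

/-- The derivative in the state of the controlled plant, in terms of the derivatives
`f'`, `h'`, `fc'`, `hc'` of its data. -/
noncomputable def controlledPlantDeriv (f' : (W × X) × U →L[ℝ] X) (h' : W × X →L[ℝ] Y)
    (fc' : C × Y →L[ℝ] C) (hc' : C × Y →L[ℝ] U) : X × C →L[ℝ] X × C :=
  let ix := (ContinuousLinearMap.inr ℝ W X).comp (ContinuousLinearMap.fst ℝ X C)
  let H := (ContinuousLinearMap.snd ℝ X C).prod (h'.comp ix)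
  (f'.comp (ix.prod (hc'.comp H))).prod (fc'.comp H)

lemma hasFDerivAt_controlledPlantField {f : (W × X) × U → X} {h : W × X → Y} {R : Regulator C Y U}
    (hf : Differentiable ℝ f) (hh : Differentiable ℝ h) (hfc : Differentiable ℝ R.fc)
    (hhc : Differentiable ℝ R.hc) (w : W) (z : X × C) :
    HasFDerivAt (controlledPlantField f h R w)
      (controlledPlantDeriv (fderiv ℝ f ((w, z.1), R.hc (z.2, h (w, z.1))))
        (fderiv ℝ h (w, z.1)) (fderiv ℝ R.fc (z.2, h (w, z.1)))
        (fderiv ℝ R.hc (z.2, h (w, z.1)))) z := by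
  have hix : HasFDerivAt (fun z : X × C => (w, z.1))
      ((ContinuousLinearMap.inr ℝ W X).comp (ContinuousLinearMap.fst ℝ X C)) z :=
    (hasFDerivAt_prodMk_right w z.1).comp z hasFDerivAt_fst
  have hH := (hasFDerivAt_snd (𝕜 := ℝ) (p := z)).prodMk ((hh (w, z.1)).hasFDerivAt.comp z hix)
  have hu := (hhc (z.2, h (w, z.1))).hasFDerivAt.comp z hH
  exact ((hf ((w, z.1), R.hc (z.2, h (w, z.1)))).hasFDerivAt.comp z (hix.prodMk hu)).prodMk
    ((hfc (z.2, h (w, z.1))).hasFDerivAt.comp z hH)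

lemma tendsto_clm_prod {α E F G : Type*} [NormedAddCommGroup E] [NormedSpace ℝ E]
    [NormedAddCommGroup F] [NormedSpace ℝ F] [NormedAddCommGroup G] [NormedSpace ℝ G]
    {l : Filter α} {A : α → E →L[ℝ] F} {B : α → E →L[ℝ] G} {A₀ : E →L[ℝ] F} {B₀ : E →L[ℝ] G}
    (hA : Tendsto A l (𝓝 A₀)) (hB : Tendsto B l (𝓝 B₀)) :
    Tendsto (fun a => (A a).prod (B a)) l (𝓝 (A₀.prod B₀)) :=
  ((ContinuousLinearMap.prodₗᵢ (𝕜 := ℝ) (E := E) (F := F) (G := G) ℝ).continuous.tendsto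
    (A₀, B₀)).comp (hA.prodMk_nhds hB)

lemma tendsto_clm_comp {α E F G : Type*} [NormedAddCommGroup E] [NormedSpace ℝ E]
    [NormedAddCommGroup F] [NormedSpace ℝ F] [NormedAddCommGroup G] [NormedSpace ℝ G]
    {l : Filter α} {A : α → F →L[ℝ] G} {B : α → E →L[ℝ] F} {A₀ : F →L[ℝ] G} {B₀ : E →L[ℝ] F}
    (hA : Tendsto A l (𝓝 A₀)) (hB : Tendsto B l (𝓝 B₀)) :
    Tendsto (fun a => (A a).comp (B a)) l (𝓝 (A₀.comp B₀)) :=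
  (isBoundedBilinearMap_comp.continuous.tendsto (A₀, B₀)).comp (hA.prodMk_nhds hB)

lemma tendsto_controlledPlantDeriv {α : Type*} {l : Filter α}
    {f' : α → (W × X) × U →L[ℝ] X} {h' : α → W × X →L[ℝ] Y} {fc' : α → C × Y →L[ℝ] C}
    {hc' : α → C × Y →L[ℝ] U} {f₀ h₀ fc₀ hc₀}
    (hf : Tendsto f' l (𝓝 f₀)) (hh : Tendsto h' l (𝓝 h₀)) (hfc : Tendsto fc' l (𝓝 fc₀))
    (hhc : Tendsto hc' l (𝓝 hc₀)) :
    Tendsto (fun a => controlledPlantDeriv (f' a) (h' a) (fc' a) (hc' a)) l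
      (𝓝 (controlledPlantDeriv f₀ h₀ fc₀ hc₀)) := by
  have hH := tendsto_clm_prod (tendsto_const_nhds (x := ContinuousLinearMap.snd ℝ X C))
    (tendsto_clm_comp hh (tendsto_const_nhds
      (x := (ContinuousLinearMap.inr ℝ W X).comp (ContinuousLinearMap.fst ℝ X C))))
  exact tendsto_clm_prod (tendsto_clm_comp hf (tendsto_clm_prod tendsto_const_nhds
    (tendsto_clm_comp hhc hH))) (tendsto_clm_comp hfc hH)

/-- At states whose nominal plant input lies in the interior of `Pb`, the controlled plant and its
derivative in the state depend continuously on the plant, the exogenous input and the state. -/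
lemma tendsto_controlledPlantField {Pb : Set ((W × X) × U)}
    {Fp : Set (((W × X) × U → X) × (W × X → Y))}
    (hFp : ∀ F ∈ Fp, ContDiff ℝ 1 F.1 ∧ ContDiff ℝ 1 F.2) (F₀ : Fp) {R : Regulator C Y U}
    (hfc : ContDiff ℝ 1 R.fc) (hhc : ContDiff ℝ 1 R.hc) {z : X × C}
    (hz : ((0, z.1), R.hc (z.2, F₀.1.2 (0, z.1))) ∈ interior Pb) :
    Tendsto (fun p : Fp × W × (X × C) => controlledPlantField p.1.1.1 p.1.1.2 R p.2.1 p.2.2)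
      ((@nhds _ (weakC2Topology Pb Fp) F₀) ×ˢ 𝓝 (0, z))
      (𝓝 (controlledPlantField F₀.1.1 F₀.1.2 R 0 z)) ∧
    Tendsto (fun p : Fp × W × (X × C) =>
        fderiv ℝ (controlledPlantField p.1.1.1 p.1.1.2 R p.2.1) p.2.2)
      ((@nhds _ (weakC2Topology Pb Fp) F₀) ×ˢ 𝓝 (0, z))
      (𝓝 (fderiv ℝ (controlledPlantField F₀.1.1 F₀.1.2 R 0) z)) := by
  set L : Filter Fp := @nhds _ (weakC2Topology Pb Fp) F₀ with hL
  set u₀ := R.hc (z.2, F₀.1.2 (0, z.1)) with hu₀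
  have hPb : Pb ∈ 𝓝 (((0 : W), z.1), u₀) := mem_interior_iff_mem_nhds.1 hz
  have hJ : ∀ F : Fp, ContDiff ℝ 1 (jointMap F.1) := fun F =>
    (hFp F F.2).1.prodMk ((hFp F F.2).2.comp contDiff_fst)
  have hJd : ∀ (F : Fp) p, HasFDerivAt (jointMap F.1) ((fderiv ℝ F.1.1 p).prod
      ((fderiv ℝ F.1.2 p.1).comp (ContinuousLinearMap.fst ℝ (W × X) U))) p := fun F p =>
    ((hFp F F.2).1.differentiable one_ne_zero p).hasFDerivAt.prodMk
      (((hFp F F.2).2.differentiable one_ne_zero p.1).hasFDerivAt.comp p hasFDerivAt_fst)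
  have tJ := (tendstoUniformlyOn_jointMap Pb Fp F₀).tendsto_prod_nhds hPb
    (hJ F₀).continuous.continuousAt
  have tJ' := (tendstoUniformlyOn_fderiv_jointMap Pb Fp F₀).tendsto_prod_nhds hPb
    ((hJ F₀).continuous_fderiv one_ne_zero).continuousAt
  -- the derivatives of `f` and `h` are the components of that of the joint map
  have tf' : Tendsto (fun q : Fp × ((W × X) × U) => fderiv ℝ q.1.1.1 q.2)
      (L ×ˢ 𝓝 ((0, z.1), u₀)) (𝓝 (fderiv ℝ F₀.1.1 ((0, z.1), u₀))) := by
    have := tendsto_clm_comp (tendsto_const_nhds (x := ContinuousLinearMap.fst ℝ X Y)) tJ'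
    simp only [(hJd _ _).fderiv] at this
    exact this
  have th' : Tendsto (fun q : Fp × ((W × X) × U) => fderiv ℝ q.1.1.2 q.2.1)
      (L ×ˢ 𝓝 ((0, z.1), u₀)) (𝓝 (fderiv ℝ F₀.1.2 (0, z.1))) := by
    have := tendsto_clm_comp
      (tendsto_clm_comp (tendsto_const_nhds (x := ContinuousLinearMap.snd ℝ X Y)) tJ')
      (tendsto_const_nhds (x := ContinuousLinearMap.inl ℝ (W × X) U))
    simp only [(hJd _ _).fderiv] at this
    exact this
  have tF : Tendsto (fun p : Fp × W × (X × C) => p.1) (L ×ˢ 𝓝 (0, z)) L := tendsto_fst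
  have twz : Tendsto (fun p : Fp × W × (X × C) => p.2) (L ×ˢ 𝓝 (0, z)) (𝓝 (0, z)) := tendsto_snd
  have twx : Tendsto (fun p : Fp × W × (X × C) => (p.2.1, p.2.2.1)) (L ×ˢ 𝓝 (0, z))
      (𝓝 (0, z.1)) := by
    have hc : Continuous fun p : W × (X × C) => (p.1, p.2.1) := by fun_prop
    exact (hc.tendsto (0, z)).comp twz
  have tc : Tendsto (fun p : Fp × W × (X × C) => p.2.2.2) (L ×ˢ 𝓝 (0, z)) (𝓝 z.2) := by
    have hc : Continuous fun p : W × (X × C) => p.2.2 := by fun_prop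
    exact (hc.tendsto (0, z)).comp twz
  have tu0 : Tendsto (fun p : Fp × W × (X × C) => (p.1, ((p.2.1, p.2.2.1), u₀)))
      (L ×ˢ 𝓝 (0, z)) (L ×ˢ 𝓝 ((0, z.1), u₀)) :=
    tF.prodMk (twx.prodMk_nhds tendsto_const_nhds)
  have ty : Tendsto (fun p : Fp × W × (X × C) => (p.2.2.2, p.1.1.2 (p.2.1, p.2.2.1)))
      (L ×ˢ 𝓝 (0, z)) (𝓝 (z.2, F₀.1.2 (0, z.1))) :=
    tc.prodMk_nhds ((continuous_snd.tendsto _).comp (tJ.comp tu0))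
  have tu : Tendsto (fun p : Fp × W × (X × C) => R.hc (p.2.2.2, p.1.1.2 (p.2.1, p.2.2.1)))
      (L ×ˢ 𝓝 (0, z)) (𝓝 u₀) := (hhc.continuous.tendsto _).comp ty
  have tp : Tendsto (fun p : Fp × W × (X × C) =>
      (p.1, ((p.2.1, p.2.2.1), R.hc (p.2.2.2, p.1.1.2 (p.2.1, p.2.2.1)))))
      (L ×ˢ 𝓝 (0, z)) (L ×ˢ 𝓝 ((0, z.1), u₀)) := tF.prodMk (twx.prodMk_nhds tu)
  have hd : ∀ (F : Fp) w z, _ := fun F w z => (hasFDerivAt_controlledPlantField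
    ((hFp F F.2).1.differentiable one_ne_zero) ((hFp F F.2).2.differentiable one_ne_zero)
    (hfc.differentiable one_ne_zero) (hhc.differentiable one_ne_zero) w z).fderiv
  constructor
  · exact ((continuous_fst.tendsto _).comp (tJ.comp tp)).prodMk_nhds
      ((hfc.continuous.tendsto _).comp ty)
  · simp only [hd]
    exact tendsto_controlledPlantDeriv (tf'.comp tp) (th'.comp tp)
      (((hfc.continuous_fderiv one_ne_zero).tendsto _).comp ty)
      (((hhc.continuous_fderiv one_ne_zero).tendsto _).comp ty)

end Convergence

/-! ### The internal model annihilates the harmonics of a periodic error -/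

section InternalModel

open Matrix

/-- The Hautus test: a controllable pair admits no left eigenvector, real or complex, that
annihilates the input matrix. -/
lemma IsControllable.eq_zero_of_vecMul {n m : ℕ} {A : Matrix (Fin n) (Fin n) ℝ}
    {B : Matrix (Fin n) (Fin m) ℝ} (h : IsControllable A B) {μ : ℂ} {v : Fin n → ℂ}
    (hA : v ᵥ* A.map (algebraMap ℝ ℂ) = μ • v) (hB : v ᵥ* B.map (algebraMap ℝ ℂ) = 0) : v = 0 := by
  set Q : Matrix (Fin n) (Fin n × Fin m) ℝ :=
    Matrix.of fun i p => (A ^ (p.1 : ℕ) * B) i p.2 with hQ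
  have hrank : Q.rank = n := h
  have hinj : ∀ u : Fin n → ℝ, u ᵥ* Q = 0 → u = 0 := by
    have h1 : Module.finrank ℝ (LinearMap.range Qᵀ.mulVecLin) = n :=
      (Matrix.rank_transpose Q).trans hrank
    have h2 := LinearMap.finrank_range_add_finrank_ker Qᵀ.mulVecLin
    rw [h1, Module.finrank_fintype_fun_eq_card, Fintype.card_fin] at h2
    have h3 : LinearMap.ker Qᵀ.mulVecLin = ⊥ := Submodule.finrank_eq_zero.1 (by omega)
    intro u hu
    refine (LinearMap.ker_eq_bot'.1 h3) u ?_
    rw [Matrix.mulVecLin_apply, Matrix.mulVec_transpose, hu]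
  have hpow : ∀ k : ℕ, v ᵥ* (A ^ k * B).map (algebraMap ℝ ℂ) = 0 := by
    intro k
    have h1 : v ᵥ* (A.map (algebraMap ℝ ℂ)) ^ k = μ ^ k • v := by
      induction k with
      | zero => simp
      | succ k ih => rw [pow_succ, ← Matrix.vecMul_vecMul, ih, Matrix.smul_vecMul, hA, smul_smul,
          pow_succ]
    rw [Matrix.map_mul, ← Matrix.vecMul_vecMul]
    have h2 : (A ^ k).map (algebraMap ℝ ℂ) = (A.map (algebraMap ℝ ℂ)) ^ k :=
      map_pow (algebraMap ℝ ℂ).mapMatrix A k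
    rw [h2, h1, Matrix.smul_vecMul, hB, smul_zero]
  -- the controllability matrix is real, so the real and imaginary parts of `v` both annihilate it
  have hre : (fun i => (v i).re) = 0 := by
    refine hinj _ (funext fun p => ?_)
    have := congrArg Complex.re (congrFun (hpow p.1) p.2)
    simpa [Matrix.vecMul, dotProduct, hQ] using this
  have him : (fun i => (v i).im) = 0 := by
    refine hinj _ (funext fun p => ?_)
    have := congrArg Complex.im (congrFun (hpow p.1) p.2)
    simpa [Matrix.vecMul, dotProduct, hQ] using this
  ext i
  exact Complex.ext (congrFun hre i) (congrFun him i)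

/-- If `[M B]` has full row rank and `ker M` has as many dimensions as `B` has columns, then the
kernel of `[M B]` is `ker M × 0`, so that `B` is injective modulo the range of `M`. -/
lemma eq_zero_of_mulVec_add_mulVec_eq_zero {K : Type*} [Field K] {n m : ℕ}
    {M : Matrix (Fin n) (Fin n) K} {B : Matrix (Fin n) (Fin m) K}
    (hker : Module.finrank K (LinearMap.ker M.mulVecLin) = m)
    (hrow : ∀ v : Fin n → K, v ᵥ* M = 0 → v ᵥ* B = 0 → v = 0) {x : Fin n → K} {c : Fin m → K}
    (h : M *ᵥ x + B *ᵥ c = 0) : c = 0 := by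
  set L := M.mulVecLin.coprod B.mulVecLin with hL
  have hsurj : LinearMap.range L = ⊤ := by
    by_contra hne
    obtain ⟨f, hf, hle⟩ := Submodule.exists_le_ker_of_lt_top _ (lt_top_iff_ne_top.2 hne)
    set v : Fin n → K := fun i => f (Pi.single i 1) with hv
    have hfv : ∀ y, f y = v ⬝ᵥ y := by
      intro y
      conv_lhs => rw [← Finset.univ_sum_single y]
      simp only [map_sum, dotProduct, hv]
      refine Finset.sum_congr rfl fun i _ => ?_
      rw [mul_comm, ← smul_eq_mul, ← map_smul, ← Pi.single_smul, smul_eq_mul, mul_one]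
    have hfL : ∀ q, f (L q) = 0 := fun q => hle (LinearMap.mem_range_self L q)
    have hv0 : v = 0 := by
      refine hrow v ?_ ?_
      · refine dotProduct_eq_zero _ fun y => ?_
        have := hfL (y, 0)
        rwa [hfv, hL, LinearMap.coprod_apply, map_zero, add_zero, Matrix.mulVecLin_apply,
          Matrix.dotProduct_mulVec] at this
      · refine dotProduct_eq_zero _ fun y => ?_
        have := hfL (0, y)
        rwa [hfv, hL, LinearMap.coprod_apply, map_zero, zero_add, Matrix.mulVecLin_apply,
          Matrix.dotProduct_mulVec] at this
    exact hf (LinearMap.ext fun y => by rw [hfv, hv0, zero_dotProduct]; rfl)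
  have hkerL : Module.finrank K (LinearMap.ker L) = m := by
    have h1 := LinearMap.finrank_range_add_finrank_ker L
    rw [hsurj, finrank_top, Module.finrank_prod, Module.finrank_fintype_fun_eq_card,
      Module.finrank_fintype_fun_eq_card, Fintype.card_fin, Fintype.card_fin] at h1
    omega
  have hle : (LinearMap.ker M.mulVecLin).map (LinearMap.inl K (Fin n → K) (Fin m → K)) ≤
      LinearMap.ker L := by
    rintro _ ⟨y, hy, rfl⟩
    simpa [hL] using hy
  have heq := Submodule.eq_of_le_of_finrank_eq hle (by
    rw [hkerL, ← (Submodule.equivMapOfInjective _ LinearMap.inl_injective _).finrank_eq, hker])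
  have hmem : (x, c) ∈ LinearMap.ker L := by simpa [hL] using h
  rw [← heq] at hmem
  obtain ⟨y, -, hy⟩ := hmem
  exact (congrArg Prod.snd hy).symm

/-- Integration by parts over a period: the Fourier integrals `X` of `η` and `c` of `e` satisfy
`Φ X + G c = μ X` when `η' = Φ η + G e` and `η` is periodic. -/
lemma mulVec_fourier_of_periodic {n m : ℕ} {Φ : Matrix (Fin n) (Fin n) ℝ}
    {G : Matrix (Fin n) (Fin m) ℝ} {η : ℝ → Euc n} {e : ℝ → Euc m} {T : ℝ} (hT : 0 ≤ T)
    (hη : ∀ t ∈ Icc 0 T, HasDerivWithinAt η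
      (Matrix.toEuclideanLin Φ (η t) + Matrix.toEuclideanLin G (e t)) (Icc 0 T) t)
    (he : ContinuousOn e (Icc 0 T)) (hper : η T = η 0) {μ : ℂ} (hμ : Complex.exp (-(μ * T)) = 1) :
    (Φ.map (algebraMap ℝ ℂ) - μ • (1 : Matrix (Fin n) (Fin n) ℂ)) *ᵥ
        (fun j => ∫ t in (0 : ℝ)..T, ((η t j : ℝ) : ℂ) * Complex.exp (-(μ * t))) +
      G.map (algebraMap ℝ ℂ) *ᵥ
        (fun j => ∫ t in (0 : ℝ)..T, ((e t j : ℝ) : ℂ) * Complex.exp (-(μ * t))) = 0 := by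
  have hηc : ContinuousOn η (Icc 0 T) := fun t ht => (hη t ht).continuousWithinAt
  have hcη : ∀ j, ContinuousOn (fun t => ((η t j : ℝ) : ℂ) * Complex.exp (-(μ * t))) (Icc 0 T) := by
    intro j
    refine ContinuousOn.mul (Complex.continuous_ofReal.comp_continuousOn ?_) (by fun_prop)
    exact (EuclideanSpace.proj (𝕜 := ℝ) j).continuous.comp_continuousOn hηc
  have hce : ∀ j, ContinuousOn (fun t => ((e t j : ℝ) : ℂ) * Complex.exp (-(μ * t))) (Icc 0 T) := by
    intro j
    refine ContinuousOn.mul (Complex.continuous_ofReal.comp_continuousOn ?_) (by fun_prop)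
    exact (EuclideanSpace.proj (𝕜 := ℝ) j).continuous.comp_continuousOn he
  have hiη : ∀ j, IntervalIntegrable (fun t => ((η t j : ℝ) : ℂ) * Complex.exp (-(μ * t)))
      MeasureTheory.volume 0 T := fun j =>
    ContinuousOn.intervalIntegrable (by rw [uIcc_of_le hT]; exact hcη j)
  have hie : ∀ j, IntervalIntegrable (fun t => ((e t j : ℝ) : ℂ) * Complex.exp (-(μ * t)))
      MeasureTheory.volume 0 T := fun j =>
    ContinuousOn.intervalIntegrable (by rw [uIcc_of_le hT]; exact hce j)
  ext i
  let F : ℝ → ℂ := fun t => (∑ j, (Φ i j : ℂ) * (((η t j : ℝ) : ℂ) * Complex.exp (-(μ * t)))) +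
    (∑ j, (G i j : ℂ) * (((e t j : ℝ) : ℂ) * Complex.exp (-(μ * t)))) -
    μ * (((η t i : ℝ) : ℂ) * Complex.exp (-(μ * t)))
  have hderiv : ∀ t ∈ Ioo (min 0 T) (max 0 T), HasDerivWithinAt
      (fun t => ((η t i : ℝ) : ℂ) * Complex.exp (-(μ * t))) (F t) (Ioi t) t := by
    intro t ht
    rw [min_eq_left hT, max_eq_right hT] at ht
    have h1 : HasDerivAt η _ t := (hη t (Ioo_subset_Icc_self ht)).hasDerivAt (Icc_mem_nhds ht.1 ht.2)
    have h2 := (EuclideanSpace.proj (𝕜 := ℝ) i).hasFDerivAt.comp_hasDerivAt t h1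
    have h3 := h2.ofReal_comp
    have h4 : HasDerivAt (fun t : ℝ => Complex.exp (-(μ * t))) (Complex.exp (-(μ * t)) * -μ) t := by
      have : HasDerivAt (fun t : ℝ => -(μ * (t : ℂ))) (-(μ * 1)) t :=
        (((hasDerivAt_id t).ofReal_comp).const_mul μ).neg
      rw [mul_one] at this
      exact this.cexp
    refine ((h3.mul h4).congr_deriv ?_).hasDerivWithinAt
    have hΦ : ∀ {k : ℕ} (M : Matrix (Fin n) (Fin k) ℝ) (v : Euc k),
        (EuclideanSpace.proj (𝕜 := ℝ) i) (Matrix.toEuclideanLin M v) = ∑ j, M i j * v j :=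
      fun M v => rfl
    rw [map_add, hΦ, hΦ]
    change _ + ((η t i : ℝ) : ℂ) * _ = _
    simp only [F]
    push_cast
    rw [add_mul, Finset.sum_mul, Finset.sum_mul]
    simp only [mul_assoc]
    ring
  have hcF : ContinuousOn F (Icc 0 T) :=
    ((continuousOn_finsetSum _ fun j _ => continuousOn_const.mul (hcη j)).add
      (continuousOn_finsetSum _ fun j _ => continuousOn_const.mul (hce j))).sub
      (continuousOn_const.mul (hcη i))
  have hFTC := intervalIntegral.integral_eq_sub_of_hasDeriv_right
    (by rw [uIcc_of_le hT]; exact hcη i) hderiv (ContinuousOn.intervalIntegrable (by rw [uIcc_of_le hT]; exact hcF))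
  have h0 : ∫ t in (0 : ℝ)..T, F t = 0 := by
    rw [hFTC, hper, hμ]; simp
  have hsum : ∀ {k : ℕ} (M : Fin k → ℝ) (φ : Fin k → ℝ → ℂ),
      (∀ j, IntervalIntegrable (φ j) MeasureTheory.volume 0 T) →
      IntervalIntegrable (fun t => ∑ j, (M j : ℂ) * φ j t) MeasureTheory.volume 0 T ∧
      ∫ t in (0 : ℝ)..T, ∑ j, (M j : ℂ) * φ j t = ∑ j, (M j : ℂ) * ∫ t in (0 : ℝ)..T, φ j t := by
    intro k M φ hφ
    refine ⟨?_, ?_⟩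
    · have := IntervalIntegrable.sum Finset.univ fun j _ => (hφ j).const_mul (M j : ℂ)
      simpa [Finset.sum_fn] using this
    · rw [intervalIntegral.integral_finsetSum fun j _ => (hφ j).const_mul _]
      simp only [intervalIntegral.integral_const_mul]
  obtain ⟨i1, e1⟩ := hsum (Φ i) _ hiη
  obtain ⟨i2, e2⟩ := hsum (G i) _ hie
  simp only [F] at h0
  rw [intervalIntegral.integral_sub (i1.add i2) ((hiη i).const_mul _),
    intervalIntegral.integral_add i1 i2, e1, e2, intervalIntegral.integral_const_mul] at h0
  rw [Matrix.sub_mulVec, Matrix.smul_mulVec, Matrix.one_mulVec]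
  simp only [Pi.add_apply, Pi.sub_apply, Pi.smul_apply, smul_eq_mul, Matrix.mulVec, dotProduct,
    Matrix.map_apply, Complex.coe_algebraMap, Pi.zero_apply]
  linear_combination h0

/-- The error driving a periodic internal model has no harmonics of index at most `d`: the
Hautus test and the geometric multiplicity of the eigenvalue `i 2πk/T` make `G` injective modulo
the range of `Φ - i 2πk/T`. -/
lemma IsHarmonicInternalModel.vanishingHarmonics_of_periodic {T : ℝ} {d ne : ℕ}
    {Φ : Matrix (Fin ((2 * d + 1) * ne)) (Fin ((2 * d + 1) * ne)) ℝ}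
    {G : Matrix (Fin ((2 * d + 1) * ne)) (Fin ne) ℝ} (hIM : IsHarmonicInternalModel T d ne Φ G)
    (hT : 0 < T) {η : ℝ → Euc ((2 * d + 1) * ne)} {e : ℝ → Euc ne}
    (hη : ∀ t ∈ Icc 0 T, HasDerivWithinAt η
      (Matrix.toEuclideanLin Φ (η t) + Matrix.toEuclideanLin G (e t)) (Icc 0 T) t)
    (he : ContinuousOn e (Icc 0 T)) (hper : η T = η 0) : e ∈ vanishingHarmonics T d ne := by
  intro k hk
  set μ : ℂ := Complex.I * (2 * Real.pi * k / T) with hμ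
  have hT0 : (T : ℂ) ≠ 0 := by exact_mod_cast hT.ne'
  have hμs : μ ∈ harmonicSpectrum T d := by
    rcases Nat.eq_zero_or_pos k with rfl | hk0
    · left; simp [hμ]
    · right
      exact mem_iUnion₂.2 ⟨k, Finset.mem_Icc.2 ⟨hk0, hk⟩, Or.inl rfl⟩
  have hμT : Complex.exp (-(μ * T)) = 1 := by
    rw [Complex.exp_eq_one_iff]
    exact ⟨-k, by rw [hμ]; push_cast; field_simp⟩
  have hmain := mulVec_fourier_of_periodic hT.le hη he hper hμT
  have hker : Module.finrank ℂ (LinearMap.ker (Φ.map (algebraMap ℝ ℂ) -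
      μ • (1 : Matrix (Fin ((2 * d + 1) * ne)) (Fin ((2 * d + 1) * ne)) ℂ)).mulVecLin) = ne := by
    have heig : LinearMap.ker (Φ.map (algebraMap ℝ ℂ) -
        μ • (1 : Matrix (Fin ((2 * d + 1) * ne)) (Fin ((2 * d + 1) * ne)) ℂ)).mulVecLin =
        Module.End.eigenspace (Matrix.toLin' (Φ.map (algebraMap ℝ ℂ))) μ := by
      ext x
      rw [Module.End.mem_eigenspace_iff, LinearMap.mem_ker, Matrix.mulVecLin_apply,
        Matrix.sub_mulVec, Matrix.smul_mulVec, Matrix.one_mulVec, sub_eq_zero,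
        Matrix.toLin'_apply]
    rw [heig]
    exact hIM.geometric_multiplicity μ hμs
  have hc := eq_zero_of_mulVec_add_mulVec_eq_zero hker (fun v hv hvB => by
    refine hIM.controllable.eq_zero_of_vecMul (μ := μ) ?_ hvB
    rwa [Matrix.vecMul_sub, Matrix.vecMul_smul, Matrix.vecMul_one, sub_eq_zero] at hv) hmain
  rw [← hc]
  funext j
  simp only [fourierCoefficient]
  congr 1
  ext t
  congr 3
  rw [hμ]
  ring

end InternalModel

/-! ### The perturbed closed loop -/

section ClosedLoop

lemma HasDerivWithinAt.clm {E F : Type*} [NormedAddCommGroup E] [NormedSpace ℝ E]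
    [NormedAddCommGroup F] [NormedSpace ℝ F] (A : E →L[ℝ] F) {x : ℝ → E} {x' : E} {s : Set ℝ}
    {t : ℝ} (h : HasDerivWithinAt x x' s t) : HasDerivWithinAt (fun u => A (x u)) (A x') s t :=
  A.hasFDerivAt.comp_hasDerivWithinAt t h

variable {W X U Y C : Type*} [NormedAddCommGroup W] [NormedSpace ℝ W]
  [NormedAddCommGroup X] [NormedSpace ℝ X] [NormedAddCommGroup C] [NormedSpace ℝ C]

/-- The component `w` of the closed-loop state. -/
def exoCLM (W X C : Type*) [NormedAddCommGroup W] [NormedSpace ℝ W] [NormedAddCommGroup X]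
    [NormedSpace ℝ X] [NormedAddCommGroup C] [NormedSpace ℝ C] : (W × X) × C →L[ℝ] W :=
  (ContinuousLinearMap.fst ℝ W X).comp (ContinuousLinearMap.fst ℝ (W × X) C)

/-- The component `(x, x_c)` of the closed-loop state. -/
def plantCLM (W X C : Type*) [NormedAddCommGroup W] [NormedSpace ℝ W] [NormedAddCommGroup X]
    [NormedSpace ℝ X] [NormedAddCommGroup C] [NormedSpace ℝ C] : (W × X) × C →L[ℝ] X × C :=
  ((ContinuousLinearMap.snd ℝ W X).comp (ContinuousLinearMap.fst ℝ (W × X) C)).prod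
    (ContinuousLinearMap.snd ℝ (W × X) C)

lemma norm_closedLoop_state (ξ : (W × X) × C) :
    ‖ξ‖ = max ‖exoCLM W X C ξ‖ ‖plantCLM W X C ξ‖ := by
  simp only [exoCLM, plantCLM, Prod.norm_def, ContinuousLinearMap.comp_apply,
    ContinuousLinearMap.prod_apply, ContinuousLinearMap.coe_fst', ContinuousLinearMap.coe_snd',
    max_assoc]

/-- The component `w` of a closed-loop solution solves the exosystem. -/
lemma IsSolution.exo {F : ExtendedPlant W X U Y} {R : Regulator C Y U}
    {ξ : Trajectory ((W × X) × C)} (hξ : IsSolution (closedLoop F R).field ξ) :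
    IsSolution F.s ⟨ξ.dom, fun t => exoCLM W X C (ξ.toFun t)⟩ :=
  ⟨hξ.1, hξ.2.1, hξ.2.2.1, fun t ht => (hξ.2.2.2 t ht).clm (exoCLM W X C)⟩

lemma IsSolution.isForcedSolution {F : ExtendedPlant W X U Y} {R : Regulator C Y U}
    {ξ : Trajectory ((W × X) × C)} (hξ : IsSolution (closedLoop F R).field ξ) {b : ℝ}
    (hb : b ∈ ξ.dom) : IsForcedSolution (controlledPlantField F.f F.h R)
      (fun t => exoCLM W X C (ξ.toFun t)) (fun t => plantCLM W X C (ξ.toFun t)) 0 b :=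
  ⟨(plantCLM W X C).continuous.comp_continuousOn
      (hξ.continuousOn.mono (hξ.Icc_subset le_rfl hb)),
    fun _ ht => (hξ.hasDerivWithinAt_Ici le_rfl hb ht).clm (plantCLM W X C)⟩

lemma IsSolution.isForcedSolution_const_add {F : ExtendedPlant W X U Y} {R : Regulator C Y U}
    {ξ : Trajectory ((W × X) × C)} (hξ : IsSolution (closedLoop F R).field ξ)
    (hdom : ξ.dom = Ici 0) {s a b : ℝ} (h : 0 ≤ s + a) :
    IsForcedSolution (controlledPlantField F.f F.h R)
      (fun t => exoCLM W X C (ξ.toFun (s + t))) (fun t => plantCLM W X C (ξ.toFun (s + t))) a b :=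
  ⟨(plantCLM W X C).continuous.comp_continuousOn (hξ.continuousOn_const_add hdom h),
    fun _ ht => (hξ.hasDerivWithinAt_const_add hdom (by linarith [ht.1])).clm (plantCLM W X C)⟩

variable [NormedAddCommGroup U] [NormedSpace ℝ U] [NormedAddCommGroup Y] [NormedSpace ℝ Y]

lemma contDiff_controlledPlantField {f : (W × X) × U → X} {h : W × X → Y} {R : Regulator C Y U}
    (hf : ContDiff ℝ 1 f) (hh : ContDiff ℝ 1 h) (hfc : ContDiff ℝ 1 R.fc)
    (hhc : ContDiff ℝ 1 R.hc) :
    ContDiff ℝ 1 fun p : W × (X × C) => controlledPlantField f h R p.1 p.2 := by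
  have hwx : ContDiff ℝ 1 fun p : W × (X × C) => (p.1, p.2.1) := by fun_prop
  have hy : ContDiff ℝ 1 fun p : W × (X × C) => (p.2.2, h (p.1, p.2.1)) :=
    (by fun_prop : ContDiff ℝ 1 fun p : W × (X × C) => p.2.2).prodMk (hh.comp hwx)
  exact (hf.comp (hwx.prodMk (hhc.comp hy))).prodMk (hfc.comp hy)

lemma contDiff_closedLoop {F : ExtendedPlant W X U Y} {R : Regulator C Y U}
    (hs : ContDiff ℝ 1 F.s) (hf : ContDiff ℝ 1 F.f) (hh : ContDiff ℝ 1 F.h)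
    (hfc : ContDiff ℝ 1 R.fc) (hhc : ContDiff ℝ 1 R.hc) :
    ContDiff ℝ 1 (closedLoop F R).field := by
  have hg := (contDiff_controlledPlantField hf hh hfc hhc).comp
    (by fun_prop : ContDiff ℝ 1 fun ξ : (W × X) × C => (ξ.1.1, (ξ.1.2, ξ.2)))
  exact ((hs.comp (contDiff_fst.comp contDiff_fst)).prodMk (contDiff_fst.comp hg)).prodMk
    (contDiff_snd.comp hg)

/-- Ultimate boundedness and periodicity of the steady state of one closed loop, from stability of
its exosystem and uniform attraction and contraction of its controlled plant. -/
lemma closedLoop_bounded_and_periodic [FiniteDimensional ℝ W] [FiniteDimensional ℝ X]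
    [FiniteDimensional ℝ C] {F : ExtendedPlant W X U Y} {R : Regulator C Y U}
    (hs : ContDiff ℝ 1 F.s) (hf : ContDiff ℝ 1 F.f) (hh : ContDiff ℝ 1 F.h)
    (hfc : ContDiff ℝ 1 R.fc) (hhc : ContDiff ℝ 1 R.hc) {Ξ : Set ((W × X) × C)}
    (hne : Ξ.Nonempty) {T : ℝ} (hT : 0 ≤ T)
    {ε B τ ρ c l : ℝ} {z₀ : X × C} {V : Set (X × C)} (hc : 0 < c) (hl : 0 < l)
    (hw : ∀ w ∈ maxSolutions F.s (exoCLM W X C '' Ξ), ∀ t ∈ w.dom, ‖w.toFun t‖ ≤ ε)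
    (hwT : ∀ ν > 0, ∃ r, ∀ w ∈ maxSolutions F.s (exoCLM W X C '' Ξ), ∀ t ≥ r, t + T ∈ w.dom →
      ‖w.toFun (t + T) - w.toFun t‖ ≤ ν)
    (hV : ∀ ξ ∈ Ξ, plantCLM W X C ξ ∈ V)
    (hattr : ∀ (w : ℝ → W) (z : ℝ → X × C) (b : ℝ), (∀ t ∈ Icc 0 b, ‖w t‖ ≤ ε) →
      IsForcedSolution (controlledPlantField F.f F.h R) w z 0 b → z 0 ∈ V →
      ∀ t ∈ Icc 0 b, ‖z t‖ ≤ B ∧ (τ ≤ t → z t ∈ Metric.closedBall z₀ ρ))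
    (hcontr : ∀ (w₁ w₂ : ℝ → W) (z₁ z₂ : ℝ → X × C) (a b μ : ℝ), a ≤ b → 0 ≤ μ →
      (∀ t ∈ Icc a b, ‖w₁ t‖ ≤ ε) →
      IsForcedSolution (controlledPlantField F.f F.h R) w₁ z₁ a b →
      IsForcedSolution (controlledPlantField F.f F.h R) w₂ z₂ a b →
      (∀ t ∈ Icc a b, z₁ t ∈ Metric.closedBall z₀ ρ) →
      (∀ t ∈ Icc a b, z₂ t ∈ Metric.closedBall z₀ ρ) →
      (∀ t ∈ Icc a b, ‖controlledPlantField F.f F.h R (w₁ t) (z₂ t) -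
        controlledPlantField F.f F.h R (w₂ t) (z₂ t)‖ ≤ μ) →
      ‖z₁ b - z₂ b‖ ≤ c * Real.exp (-l * (b - a)) * ‖z₁ a - z₂ a‖ + c * μ) :
    UniformlyUltimatelyBounded (closedLoop F R).field Ξ ∧
      ∀ ξ ∈ steadyStateTrajectories (closedLoop F R).field Ξ,
        ξ.dom = Ici 0 ∧ ξ.toFun T = ξ.toFun 0 := by
  have hcl := contDiff_closedLoop hs hf hh hfc hhc
  have hexo : ∀ ξ ∈ maxSolutions (closedLoop F R).field Ξ, ∀ t ∈ ξ.dom,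
      ‖exoCLM W X C (ξ.toFun t)‖ ≤ ε := by
    intro ξ hξ t ht
    -- the bound is known for maximal solutions only, and the domain of `ξ` may still be short
    obtain ⟨w, hwm, hsub, heq⟩ := exists_maximalExtension hξ.1.1.exo
    have h0 : w.toFun 0 = exoCLM W X C (ξ.toFun 0) := (heq hξ.1.1.1).symm
    have := hw w ⟨hwm, h0 ▸ mem_image_of_mem _ hξ.2⟩ t (hsub ht)
    rwa [← heq ht] at this
  have hplant : ∀ ξ ∈ maxSolutions (closedLoop F R).field Ξ, ∀ t ∈ ξ.dom,
      ‖plantCLM W X C (ξ.toFun t)‖ ≤ B ∧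
        (τ ≤ t → plantCLM W X C (ξ.toFun t) ∈ Metric.closedBall z₀ ρ) := by
    intro ξ hξ t ht
    exact hattr _ _ t (fun s hs => hexo ξ hξ s (hξ.1.1.Icc_subset le_rfl ht hs))
      (hξ.1.1.isForcedSolution ht) (hV _ hξ.2) t ⟨hξ.1.1.2.1 ht, le_rfl⟩
  have hbdd : ∀ ξ ∈ maxSolutions (closedLoop F R).field Ξ, ∀ t ∈ ξ.dom,
      ‖ξ.toFun t‖ ≤ max ε B := by
    intro ξ hξ t ht
    rw [norm_closedLoop_state]
    exact max_le_max (hexo ξ hξ t ht) (hplant ξ hξ t ht).1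
  have hdom : ∀ ξ ∈ maxSolutions (closedLoop F R).field Ξ, ξ.dom = Ici 0 := fun ξ hξ =>
    hξ.1.dom_eq_Ici hcl (hbdd ξ hξ)
  refine ⟨⟨Metric.closedBall 0 (max ε B), Metric.isBounded_closedBall, 0, le_rfl, ?_, ?_⟩,
    fun ξ hξ => steadyStateTrajectories_periodic hcl hT (R := max ε B)
      (fun x hx => ⟨hdom x hx, fun t ht => hbdd x hx t ((hdom x hx).symm ▸ ht)⟩) ?_ hξ⟩
  · rintro _ ⟨x, hx, t, ht, -, rfl⟩
    simpa using hbdd x hx t ht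
  · obtain ⟨p, hp⟩ := hne
    obtain ⟨x, hx, hx0⟩ := exists_isMaximalSolution (closedLoop F R).field p
    exact ⟨x.toFun 0, x, ⟨hx, hx0 ▸ hp⟩, 0, hx.1.1, le_rfl, rfl⟩
  intro m hm
  obtain ⟨Λ, hΛ⟩ := ((contDiff_controlledPlantField hf hh hfc hhc).contDiffOn
    (s := Metric.closedBall (0 : W) ε ×ˢ Metric.closedBall z₀ ρ)).exists_lipschitzOnWith
    one_ne_zero ((convex_closedBall _ _).prod (convex_closedBall _ _))
    ((isCompact_closedBall _ _).prod (isCompact_closedBall _ _))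
  -- `ν` bounds the increment of `w`; after the time `S` the initial discrepancy has decayed
  obtain ⟨ν, hν, hνm, hνc⟩ : ∃ ν > 0, ν ≤ m ∧ c * (Λ * ν) ≤ m / 2 := by
    refine ⟨min m (m / (2 * (c * Λ + 1))), by positivity, min_le_left _ _, ?_⟩
    calc c * (Λ * min m (m / (2 * (c * Λ + 1)))) ≤ c * (Λ * (m / (2 * (c * Λ + 1)))) := by
          gcongr; exact min_le_right _ _
      _ = m / 2 * (c * Λ / (c * Λ + 1)) := by field_simp
      _ ≤ m / 2 := mul_le_of_le_one_right (by positivity)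
        (by rw [div_le_one (by positivity)]; linarith)
  obtain ⟨S, hS0, hS⟩ : ∃ S, 0 ≤ S ∧ c * Real.exp (-l * S) * (ρ + ρ) ≤ m / 2 := by
    have h1 : Tendsto (fun S : ℝ => Real.exp (-l * S)) atTop (𝓝 0) :=
      Real.tendsto_exp_atBot.comp (tendsto_id.const_mul_atTop_of_neg (by linarith))
    have h2 := (h1.const_mul c).mul_const (ρ + ρ)
    rw [mul_zero, zero_mul] at h2
    obtain ⟨S, hS, hS0⟩ := ((h2.eventually_lt_const (half_pos hm)).and
      (eventually_ge_atTop 0)).exists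
    exact ⟨S, hS0, hS.le⟩
  obtain ⟨r, hr⟩ := hwT ν hν
  refine ⟨max (max r τ) 0 + S, fun x hx t ht => ?_⟩
  have hd := hdom x hx
  have hmem : ∀ {s}, 0 ≤ s → s ∈ x.dom := fun hs => by rw [hd]; exact hs
  have hrt : r ≤ t - S := by linarith [le_max_left (max r τ) 0, le_max_left r τ]
  have hτt : τ ≤ t - S := by linarith [le_max_left (max r τ) 0, le_max_right r τ]
  have h0t : 0 ≤ t - S := by linarith [le_max_right (max r τ) 0]
  have hwx : (⟨x.dom, fun t => exoCLM W X C (x.toFun t)⟩ : Trajectory W) ∈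
      maxSolutions F.s (exoCLM W X C '' Ξ) :=
    ⟨hx.1.1.exo.isMaximalSolution_of_dom_eq hd, mem_image_of_mem _ hx.2⟩
  have hinc : ∀ u, t - S ≤ u →
      ‖exoCLM W X C (x.toFun (T + u)) - exoCLM W X C (x.toFun u)‖ ≤ ν := by
    intro u hu
    have := hr _ hwx u (hrt.trans hu) (hmem (by linarith))
    rwa [add_comm u T] at this
  have hball : ∀ u, t - S ≤ u → plantCLM W X C (x.toFun u) ∈ Metric.closedBall z₀ ρ := fun u hu =>
    (hplant x hx u (hmem (by linarith))).2 (hτt.trans hu)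
  have hf2 := hx.1.1.isForcedSolution_const_add hd (s := 0) (a := t - S) (b := t) (by linarith)
  simp only [zero_add] at hf2
  have hz := hcontr (fun u => exoCLM W X C (x.toFun (T + u)))
    (fun u => exoCLM W X C (x.toFun u)) (fun u => plantCLM W X C (x.toFun (T + u)))
    (fun u => plantCLM W X C (x.toFun u)) (t - S) t (Λ * ν) (by linarith) (by positivity)
    (fun u hu => hexo x hx _ (hmem (by linarith [hu.1])))
    (hx.1.1.isForcedSolution_const_add hd (by linarith)) hf2
    (fun u hu => hball _ (by linarith [hu.1])) (fun u hu => hball _ hu.1)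
    (fun u hu => by
      have h1 : ∀ v, t - S ≤ v → exoCLM W X C (x.toFun v) ∈ Metric.closedBall (0 : W) ε :=
        fun v hv => by simpa using hexo x hx v (hmem (by linarith))
      have h2 := hΛ.dist_le_mul
        (exoCLM W X C (x.toFun (T + u)), plantCLM W X C (x.toFun u))
        ⟨h1 _ (by linarith [hu.1]), hball u hu.1⟩
        (exoCLM W X C (x.toFun u), plantCLM W X C (x.toFun u)) ⟨h1 _ hu.1, hball u hu.1⟩
      rw [dist_prod_same_right, dist_eq_norm, dist_eq_norm] at h2
      exact h2.trans (mul_le_mul_of_nonneg_left (hinc u hu.1) Λ.2))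
  have hdiam : ‖plantCLM W X C (x.toFun (T + (t - S))) - plantCLM W X C (x.toFun (t - S))‖ ≤
      ρ + ρ := by
    rw [← dist_eq_norm]
    exact (dist_triangle_right _ _ z₀).trans (add_le_add
      (hball (T + (t - S)) (by linarith)) (hball (t - S) le_rfl))
  rw [sub_sub_cancel] at hz
  rw [norm_closedLoop_state, map_sub, map_sub, add_comm t T]
  refine max_le ((hinc t (by linarith)).trans hνm) (hz.trans ?_)
  have := mul_le_mul_of_nonneg_left hdiam
    (by positivity : 0 ≤ c * Real.exp (-l * S))
  linarith

end ClosedLoop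

/-! ### Robustness -/

section Robustness

lemma eventually_forall_norm_lt_hausdorff {A : Type*} [NormedAddCommGroup A] {δ : ℝ}
    (hδ : 0 < δ) : ∀ᶠ K : NonemptyCompacts A in @nhds _ (hausdorffTopology A) {0},
      ∀ x ∈ (K : Set A), ‖x‖ < δ := by
  have h : Metric.ball ({0} : NonemptyCompacts A) δ ∈
      @nhds (NonemptyCompacts A) (hausdorffTopology A) {0} := Metric.ball_mem_nhds _ hδ
  filter_upwards [h] with K hK x hx
  rw [Metric.mem_ball, Metric.NonemptyCompacts.dist_eq] at hK
  obtain ⟨y, hy, hxy⟩ := Metric.exists_dist_lt_of_hausdorffDist_lt hx hK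
    (Metric.hausdorffEDist_ne_top_of_nonempty_of_bounded K.nonempty
      ({0} : NonemptyCompacts A).nonempty K.isCompact.isBounded
      ({0} : NonemptyCompacts A).isCompact.isBounded)
  have hy0 : y = 0 := by simpa using hy
  simpa [hy0] using hxy

variable {W X U Y C : Type*} [NormedAddCommGroup W] [NormedSpace ℝ W]
  [NormedAddCommGroup X] [NormedSpace ℝ X] [NormedAddCommGroup U] [NormedSpace ℝ U]
  [NormedAddCommGroup Y] [NormedSpace ℝ Y] [NormedAddCommGroup C] [NormedSpace ℝ C]

/-- For all perturbations in a neighbourhood of the nominal value the closed loop is uniformly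
ultimately bounded, and its steady-state trajectories exist for all times and are `T`-periodic. -/
lemma exists_nhds_bounded_and_periodic [FiniteDimensional ℝ W] [FiniteDimensional ℝ X]
    [FiniteDimensional ℝ C] {T : ℝ} (hT : 0 ≤ T)
    {Fw : Set (W → W)} (hFw : ∀ s ∈ Fw, ContDiff ℝ 1 s) (τw : TopologicalSpace Fw)
    {Pb : Set ((W × X) × U)} {Fp : Set (((W × X) × U → X) × (W × X → Y))}
    (hFp : ∀ F ∈ Fp, ContDiff ℝ 1 F.1 ∧ ContDiff ℝ 1 F.2) (s₀ : Fw) (F₀ : Fp)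
    {R : Regulator C Y U} (hfc : ContDiff ℝ 1 R.fc) (hhc : ContDiff ℝ 1 R.hc)
    (hXc : IsCompact R.Xc) (hXc_ne : R.Xc.Nonempty)
    (hexo : ExosystemAssumption T Fw τw s₀)
    (hLES : ∃ z₀, LocallyExpStableAttracting (controlledPlantField F₀.1.1 F₀.1.2 R 0) z₀
      ({0} ×ˢ R.Xc))
    (hlarge : closure (zeroInputExcursion F₀.1.1 F₀.1.2 R) ⊆ interior Pb) :
    ∃ N ∈ @nhds _ (productTopology (productTopology τw (weakC2Topology Pb Fp))
        (hausdorffTopology (W × X))) ((s₀, F₀), {0}),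
      ∀ p ∈ N, UniformlyUltimatelyBounded
          (closedLoop (ExtendedPlant.mk p.1.1.1 p.1.2.1.1 p.1.2.1.2) R).field
          ((p.2 : Set (W × X)) ×ˢ R.Xc) ∧
        ∀ ξ ∈ steadyStateTrajectories
            (closedLoop (ExtendedPlant.mk p.1.1.1 p.1.2.1.1 p.1.2.1.2) R).field
            ((p.2 : Set (W × X)) ×ˢ R.Xc),
          ξ.dom = Ici 0 ∧ ξ.toFun T = ξ.toFun 0 := by
  obtain ⟨z₀, hles⟩ := hLES
  have hg : ∀ F : Fp, ContDiff ℝ 1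
      fun p : W × (X × C) => controlledPlantField F.1.1 F.1.2 R p.1 p.2 := fun F =>
    contDiff_controlledPlantField (hFp F F.2).1 (hFp F F.2).2 hfc hhc
  have hgw : ∀ (F : Fp) (w : W), ContDiff ℝ 1 (controlledPlantField F.1.1 F.1.2 R w) :=
    fun F w => (hg F).comp (contDiff_const.prodMk contDiff_id)
  set ψ : X × C → (W × X) × U := fun z => ((0, z.1), R.hc (z.2, F₀.1.2 (0, z.1))) with hψ
  have hψc : Continuous ψ := by
    have h1 := hhc.continuous
    have h2 := (hFp F₀ F₀.2).2.continuous
    fun_prop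
  have hexc : ∀ z ∈ maxSolutions (controlledPlantField F₀.1.1 F₀.1.2 R 0) ({0} ×ˢ R.Xc),
      ∀ t ∈ z.dom, ψ (z.toFun t) ∈ zeroInputExcursion F₀.1.1 F₀.1.2 R :=
    fun z hz t ht => ⟨z, hz, t, ht, rfl⟩
  -- the equilibrium is a limit of nominal trajectories, hence also in the admissible region
  have hz₀ : ψ z₀ ∈ interior Pb := by
    obtain ⟨xc, hxc⟩ := hXc_ne
    obtain ⟨ζ, hζ, hζ0⟩ := exists_isMaximalSolution
      (controlledPlantField F₀.1.1 F₀.1.2 R 0) ((0 : X), xc)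
    have hζm : ζ ∈ maxSolutions (controlledPlantField F₀.1.1 F₀.1.2 R 0) ({0} ×ˢ R.Xc) :=
      ⟨hζ, by rw [hζ0]; exact ⟨rfl, hxc⟩⟩
    obtain ⟨hdom, hlim⟩ := hles.2.2 ζ hζm
    refine hlarge (mem_closure_of_tendsto ((hψc.tendsto z₀).comp hlim) ?_)
    filter_upwards [eventually_ge_atTop 0] with t ht
    exact hexc ζ hζm t (hdom ▸ ht)
  obtain ⟨V, hV, ε, hε, B, τ, ρ, c, hc, l, hl, hev⟩ := exists_uniform_attraction
    (L := @nhds _ (weakC2Topology Pb Fp) F₀)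
    (g := fun F : Fp => controlledPlantField F.1.1 F.1.2 R)
    (fun F w => (hgw F w).differentiable one_ne_zero) (hgw F₀ 0)
    (isCompact_singleton.prod hXc) hles (O := ψ ⁻¹' interior Pb)
    (isOpen_interior.preimage hψc) hz₀
    (fun z hz t ht => hlarge (subset_closure (hexc z hz t ht)))
    (fun z hz => (tendsto_controlledPlantField hFp F₀ hfc hhc hz).1)
    (tendsto_controlledPlantField hFp F₀ hfc hhc hz₀).2
  obtain ⟨δ₁, hδ₁, hδV⟩ := (Metric.hasBasis_nhdsSet_thickening
    (isCompact_singleton.prod hXc)).mem_iff.1 hV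
  obtain ⟨Nw, hNw, hstab, hper⟩ := hexo
  obtain ⟨δ₂, hδ₂, hδε⟩ := hstab ε hε
  have hmem := prod_mem_prod (prod_mem_prod hNw hev)
    (eventually_forall_norm_lt_hausdorff (A := W × X) (lt_min hδ₁ hδ₂))
  have hnhds : @nhds _ (productTopology (productTopology τw (weakC2Topology Pb Fp))
      (hausdorffTopology (W × X))) ((s₀, F₀), {0}) =
      (@nhds _ τw s₀ ×ˢ @nhds _ (weakC2Topology Pb Fp) F₀) ×ˢ
        @nhds _ (hausdorffTopology (W × X)) {0} := by
    rw [@nhds_prod_eq _ _ (productTopology τw (weakC2Topology Pb Fp)) (hausdorffTopology (W × X)),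
      @nhds_prod_eq _ _ τw (weakC2Topology Pb Fp)]
  rw [← hnhds] at hmem
  refine ⟨_, hmem, ?_⟩
  rintro ⟨⟨s, F⟩, K⟩ ⟨⟨hs, hattr, hcontr⟩, hK⟩
  have hw0 : ∀ p ∈ exoCLM W X C '' ((K : Set (W × X)) ×ˢ R.Xc), ‖p‖ ≤ δ₂ := by
    rintro _ ⟨ξ, hξ, rfl⟩
    exact ((norm_fst_le ξ.1).trans (hK ξ.1 hξ.1).le).trans (min_le_right _ _)
  refine closedLoop_bounded_and_periodic (hFw s s.2) (hFp F F.2).1 (hFp F F.2).2 hfc hhc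
    (K.nonempty.prod hXc_ne) hT hc hl
    (fun w hw t ht => hδε s hs w ⟨hw.1, trivial⟩ (hw0 _ hw.2) t ht)
    (fun ν hν => ?_) (fun ξ hξ => ?_) hattr hcontr
  · obtain ⟨r, -, hr⟩ := hper s hs ν hν _ ((K.isCompact.prod hXc).image (exoCLM W X C).continuous)
    exact ⟨r, hr⟩
  · refine hδV (Metric.mem_thickening_iff.2 ⟨(0, ξ.2), ⟨rfl, hξ.2⟩, ?_⟩)
    have h1 : ‖ξ.1.2‖ < δ₁ :=
      (norm_snd_le ξ.1).trans_lt ((hK ξ.1 hξ.1).trans_le (min_le_left _ _))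
    rw [Prod.dist_eq]
    simpa [plantCLM, hδ₁] using h1

end Robustness

/-! ### The regulator with a linear internal model -/

theorem mainTheorem5
    (nw nx nu ne na nst d : ℕ) (T : ℝ) (hT : 0 < T)
    -- the class of exosystems, with an arbitrary topology
    (Fw : Set (Euc nw → Euc nw)) (hFw : ∀ s ∈ Fw, ContDiff ℝ 1 s)
    (τw : TopologicalSpace Fw)
    -- the class of plants, with the weak `C²` topology on `Xb × Ub`
    (Fp : Set (((Euc nw × Euc nx) × Euc nu → Euc nx) × (Euc nw × Euc nx → Euc ne × Euc na)))
    (hFp : ∀ F ∈ Fp, ContDiff ℝ 2 F.1 ∧ ContDiff ℝ 2 F.2)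
    (Xb : Set (Euc nw × Euc nx)) (hXb : IsCompact Xb) (hXb0 : Xb ∈ 𝓝 0)
    (Ub : Set (Euc nu)) (hUb : IsCompact Ub) (hUb0 : Ub ∈ 𝓝 0)
    -- the nominal data
    (s₀ : Fw) (F₀ : Fp)
    -- the regulator
    (Φ : Matrix (Fin ((2 * d + 1) * ne)) (Fin ((2 * d + 1) * ne)) ℝ)
    (G : Matrix (Fin ((2 * d + 1) * ne)) (Fin ne) ℝ)
    (fst : Euc nst × Euc ((2 * d + 1) * ne) × (Euc ne × Euc na) → Euc nst)
    (hc : Euc nst × Euc ((2 * d + 1) * ne) × (Euc ne × Euc na) → Euc nu)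
    (Xc : Set (Euc ((2 * d + 1) * ne) × Euc nst))
    (hXc : IsCompact Xc) (hXc_ne : Xc.Nonempty)
    (hfst : ContDiff ℝ 2 fst) (hhc : ContDiff ℝ 2 hc)
    (hIM : IsHarmonicInternalModel T d ne Φ G)
    -- the exosystem is marginally stable and asymptotically `T`-periodic
    (hexo : ExosystemAssumption T Fw τw s₀)
    -- the nominal controlled plant with `w = 0` is locally exponentially stable
    (hLES : ∃ z₀, LocallyExpStableAttracting
      (controlledPlantField F₀.1.1 F₀.1.2 (linearIMRegulator Φ G fst hc Xc) 0) z₀ ({0} ×ˢ Xc))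
    -- `Xb` and `Ub` are large enough
    (hlarge : closure (zeroInputExcursion F₀.1.1 F₀.1.2 (linearIMRegulator Φ G fst hc Xc)) ⊆
      interior (Xb ×ˢ Ub)) :
    IsRobust (fun F : Fw × Fp => ExtendedPlant.mk F.1.1 F.2.1.1 F.2.1.2)
      (linearIMRegulator Φ G fst hc Xc) (propertyPT T d ne)
      (productTopology (productTopology τw (weakC2Topology (Xb ×ˢ Ub) Fp))
        (hausdorffTopology (Euc nw × Euc nx)))
      (s₀, F₀) {0} := by
  set R := linearIMRegulator Φ G fst hc Xc with hR
  have hhc1 : ContDiff ℝ 1 R.hc := (hhc.of_le one_le_two).comp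
    (by fun_prop : ContDiff ℝ 1 fun q : (Euc ((2 * d + 1) * ne) × Euc nst) × (Euc ne × Euc na) =>
      (q.1.2, q.1.1, q.2))
  have hfc1 : ContDiff ℝ 1 R.fc := by
    have hst : ContDiff ℝ 1 fun q : (Euc ((2 * d + 1) * ne) × Euc nst) × (Euc ne × Euc na) =>
        fst (q.1.2, q.1.1, q.2) := (hfst.of_le one_le_two).comp (by fun_prop)
    have hΦ : ContDiff ℝ 1 fun q : (Euc ((2 * d + 1) * ne) × Euc nst) × (Euc ne × Euc na) =>
        Matrix.toEuclideanLin Φ q.1.1 :=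
      (LinearMap.toContinuousLinearMap (Matrix.toEuclideanLin Φ)).contDiff.comp (by fun_prop)
    have hG : ContDiff ℝ 1 fun q : (Euc ((2 * d + 1) * ne) × Euc nst) × (Euc ne × Euc na) =>
        Matrix.toEuclideanLin G q.2.1 :=
      (LinearMap.toContinuousLinearMap (Matrix.toEuclideanLin G)).contDiff.comp (by fun_prop)
    exact (hΦ.add hG).prodMk hst
  obtain ⟨N, hN, h⟩ := exists_nhds_bounded_and_periodic hT.le hFw τw (Pb := Xb ×ˢ Ub)
    (fun F hF => ⟨(hFp F hF).1.of_le one_le_two, (hFp F hF).2.of_le one_le_two⟩) s₀ F₀ hfc1 hhc1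
    hXc hXc_ne hexo hLES hlarge
  refine ⟨N, hN, fun p hp => ⟨(h p hp).1, fun ξ hξ => ?_⟩⟩
  obtain ⟨hdom, hper⟩ := (h p hp).2 ξ hξ
  have hsol := hξ.1.1
  have hsub : Icc 0 T ⊆ ξ.dom := fun t ht => hdom ▸ ht.1
  refine ⟨hdom.ge, hIM.vanishingHarmonics_of_periodic hT (η := fun t => (ξ.toFun t).2.1)
    (fun t ht => ?_) ?_ (by simp only [hper])⟩
  · exact ((hsol.2.2.2 t (hsub ht)).mono hsub).clm ((ContinuousLinearMap.fst ℝ _ _).comp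
      (ContinuousLinearMap.snd ℝ (Euc nw × Euc nx) (Euc ((2 * d + 1) * ne) × Euc nst)))
  · have hh := (hFp p.1.2 p.1.2.2).2.continuous
    exact (continuous_fst.comp (hh.comp continuous_fst)).comp_continuousOn
      (hsol.continuousOn.mono hsub)
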